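/- A graph here is a finite undirected graph in which loops and multiple edges are allowed; an isomorphism of graphs is a pair of bijections, between the vertex sets and between the edge sets, that preserves incidence. A loop counts twice towards the degree of its vertex. Let $G$ be a graph with vertex set $V$ and edge set $E$. Its rank is $r = |E| - |V| + 1$. Let $\mathcal{A}$ be its adjacency matrix (the off-diagonal entry at $(v,w)$ is the number of edges joining $v$ and $w$, the diagonal entry at $v$ is twice the number of loops at $v$), and let $\mathcal{Q} = \mathcal{D} - I$, where $\mathcal{D}$ is the diagonal matrix of vertex degrees. The Ihara zeta function of $G$ is the rational function $\zeta_G(u)$ given by $$\zeta_G(u)^{-1} = (1-u^2)^{r-1} \det\left(I - \mathcal{A}u + \mathcal{Q}u^2\right).$$ **Theorem.** Let $G_1$ and $G_2$ be connected graphs of rank two with no vertices of degree 1. Then $G_1$ and $G_2$ are isomorphic if and only if $\zeta_{G_1}(u) = \zeta_{G_2}(u)$. -/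

import Mathlib

open scoped Graph

namespace Graph

variable {α β α' β' : Type*}

/-- The degree of `x`: the number of edges at `x`, every loop being counted twice. -/
noncomputable def degree (G : Graph α β) (x : α) : ℕ :=
  {e | G.IsNonloopAt e x}.ncard + 2 * {e | G.IsLoopAt e x}.ncard

/-- A graph is connected if it is nonempty and any two vertices are joined by a walk. -/
def Connected (G : Graph α β) : Prop :=
  V(G).Nonempty ∧ ∀ x ∈ V(G), ∀ y ∈ V(G), Relation.ReflTransGen G.Adj x y

/-- The rank `|E| - |V| + 1` of a finite graph, as an integer. -/
noncomputable def rank (G : Graph α β) : ℤ :=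
  (E(G).ncard : ℤ) - (V(G).ncard : ℤ) + 1

open Classical in
/-- The adjacency matrix: off the diagonal the number of edges joining the two vertices, on the
diagonal twice the number of loops. -/
noncomputable def adjMatrix (G : Graph α β) : Matrix V(G) V(G) ℕ :=
  fun x y => if x = y then 2 * {e | G.IsLoopAt e x}.ncard else {e | G.IsLink e x y}.ncard

open Classical in
/-- The matrix `I - A u + Q u ^ 2`, with `A` the adjacency matrix, `Q = D - I`, and `D` the
diagonal matrix of the degrees; its entries are polynomials in `u`. -/
noncomputable def zetaMatrix (G : Graph α β) : Matrix V(G) V(G) (Polynomial ℂ) :=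
  1 - (Polynomial.X : Polynomial ℂ) • (G.adjMatrix.map fun k => (k : Polynomial ℂ))
    + (Polynomial.X ^ 2 : Polynomial ℂ) •
      (Matrix.diagonal (fun x : V(G) => (G.degree x : Polynomial ℂ)) - 1)

open Classical in
/-- The Ihara zeta function of a finite graph, as a rational function of `u`:
`ζ(u)⁻¹ = (1 - u ^ 2) ^ (r - 1) * det (I - A u + Q u ^ 2)`, with `r` the rank. The exponent
`r - 1` is an integer. -/
noncomputable def iharaZeta (G : Graph α β) [Fintype V(G)] : RatFunc ℂ :=
  ((1 - RatFunc.X ^ 2) ^ (G.rank - 1) *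
    algebraMap (Polynomial ℂ) (RatFunc ℂ) G.zetaMatrix.det)⁻¹

/-- An isomorphism of multigraphs: a bijection of the vertices and a bijection of the edges that
preserve and reflect incidence. -/
structure Iso (G : Graph α β) (H : Graph α' β') where
  vertexEquiv : V(G) ≃ V(H)
  edgeEquiv : E(G) ≃ E(H)
  isLink_iff : ∀ (e : E(G)) (x y : V(G)),
    G.IsLink e x y ↔ H.IsLink (edgeEquiv e) (vertexEquiv x) (vertexEquiv y)

/-- Two multigraphs are isomorphic. -/
def Isomorphic (G : Graph α β) (H : Graph α' β') : Prop := Nonempty (Iso G H)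

end Graph

/-!
The zeta function only depends on the adjacency matrix, and two graphs are isomorphic exactly when
their adjacency matrices agree up to a bijection of the vertices. So a graph is treated as a
symmetric matrix over `ℕ`, which is the sum of the matrices `edgeMat` of its edges.

Suppressing the vertices of degree two one at a time (`IsRankTwoOn.exists_contract`) leaves a graph
with all degrees at least three, which for rank two is a bouquet with two loops, a theta graph or a
dumbbell (`IsRankTwoOn.exists_of_three_le`). Undoing the suppression shows that the graph is a
subdivision of one of these three, recorded as lists of interior vertices of paths (*ears*). The
isomorphism type is then given by the lengths `a`, `b`, `c` of the ears.

To compute the zeta function, divide `I - A u + Q u ^ 2` by `1 - u ^ 2`; the result is the identity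
plus a sum of one term `linkMat u p q` per edge. The Schur complement at a vertex of degree two
replaces two successive links of weights `s` and `t` by one link of weight `s * t`
(`det_one_add_linkMat_add_linkMat`), so that only a determinant of size at most two on the branch
vertices is left (`det_fieldZetaMatrix`). With `S = 1 - u ^ (a + b) - u ^ (a + c) - u ^ (b + c)`,
`R = (1 - u ^ a) * (1 - u ^ b)` and `m = a + b + c` the number of edges, the reciprocal of the zeta
function is `S ^ 2 - 4 * u ^ (2 * m)` for the theta graph and `R ^ 2 - 4 * u ^ (m + c) * R` for the
dumbbell with loops of lengths `a` and `b` joined by a path of length `c`; the bouquet is the case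
`c = 0` of the latter.

These polynomials determine the lengths. Their degree is `2 * m`. If two of them agree, then the
corresponding `S` or `R` have squares that differ by a multiple of a high power of `u`, hence they
differ by a multiple of that power themselves, and comparing degrees and values at `u = 1` shows
that two thetas have the same `S`, two dumbbells have the same `R`, and that a theta never agrees
with a dumbbell or bouquet.
-/

open scoped Graph

namespace Graph

/-! ### Subdivisions of graphs of rank two -/

section Ears

variable {V : Type*} [DecidableEq V]

/-- The adjacency matrix of a single edge joining `p` and `q`; a loop contributes `2` to the
diagonal. -/
def edgeMat (p q : V) : Matrix V V ℕ := Matrix.single p q 1 + Matrix.single q p 1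

lemma edgeMat_apply (p q x y : V) :
    edgeMat p q x y = (if x = p ∧ y = q then 1 else 0) + if x = q ∧ y = p then 1 else 0 := by
  simp only [edgeMat, Matrix.add_apply, Matrix.single_apply, eq_comm]

lemma edgeMat_comm (p q : V) : edgeMat p q = edgeMat q p := add_comm _ _

lemma edgeMat_symm (p q x y : V) : edgeMat p q x y = edgeMat p q y x := by
  rw [edgeMat_apply, edgeMat_apply, add_comm]
  simp only [and_comm]

lemma even_edgeMat_diag (p q x : V) : Even (edgeMat p q x x) := by
  rw [edgeMat_apply]
  simp only [and_comm (a := x = q)]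
  exact ⟨_, rfl⟩

/-- An edge contributes one to the degree of each of its ends, and two if it is a loop. -/
lemma sum_edgeMat [Fintype V] (p q x : V) :
    ∑ y, edgeMat p q x y = (if x = p then 1 else 0) + if x = q then 1 else 0 := by
  simp only [edgeMat_apply, Finset.sum_add_distrib]
  congr 1
  · by_cases h : x = p <;> simp [h]
  · by_cases h : x = q <;> simp [h]

/-- The adjacency matrix of a path from `P` to `Q` whose interior vertices are, in order, the
members of the list. -/
def earMat : V → List V → V → Matrix V V ℕ
  | P, [], Q => edgeMat P Q
  | P, v :: l, Q => edgeMat P v + earMat v l Q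

/-- A path in a graph, given by its two ends and the list of its interior vertices. -/
structure Ear (V : Type*) where
  first : V
  interior : List V
  last : V

/-- The pair of ends of an ear. -/
def Ear.ends {V : Type*} (e : Ear V) : V × V := (e.first, e.last)

/-- The adjacency matrix of an ear. -/
def Ear.mat (e : Ear V) : Matrix V V ℕ := earMat e.first e.interior e.last

/-- The multigraph with adjacency matrix `A` and vertex set `S` is made of the given ears: their
ends lie in the list `B` of branch vertices, and the branch vertices together with the interior
vertices of the ears enumerate `S` without repetition. -/
structure IsEarDecomposition (A : Matrix V V ℕ) (S : Finset V) (B : List V)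
    (ears : List (Ear V)) : Prop where
  nodup : (B ++ ears.flatMap Ear.interior).Nodup
  mem_iff : ∀ x, x ∈ B ++ ears.flatMap Ear.interior ↔ x ∈ S
  ends_mem : ∀ e ∈ ears, e.first ∈ B ∧ e.last ∈ B
  eq_sum : A = (ears.map Ear.mat).sum

/-- The three multigraphs of rank two without vertices of degree at most two, each given by its
list of vertices and its list of edges: the bouquet, the theta graph and the dumbbell. -/
def IsRankTwoShape {V : Type*} (B : List V) (es : List (V × V)) : Prop :=
  (∃ P, B = [P] ∧ es = [(P, P), (P, P)]) ∨
  (∃ P Q, B = [P, Q] ∧ es = [(P, Q), (P, Q), (P, Q)]) ∨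
  (∃ P Q, B = [P, Q] ∧ es = [(P, P), (P, Q), (Q, Q)])

/-- Subdividing an edge of a path by a new vertex `v`. -/
lemma exists_earMat_insert (v : V) {p q : V} (l : List V) (P Q : V) (h : earMat P l Q p q ≠ 0) :
    ∃ l₁ l₂, l = l₁ ++ l₂ ∧
      earMat P (l₁ ++ v :: l₂) Q + edgeMat p q = earMat P l Q + (edgeMat p v + edgeMat v q) := by
  have key : ∀ a b : V, edgeMat a b p q ≠ 0 →
      edgeMat a v + edgeMat v b + edgeMat p q = edgeMat a b + (edgeMat p v + edgeMat v q) := by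
    intro a b hab
    rw [edgeMat_apply] at hab
    have : (p = a ∧ q = b) ∨ (p = b ∧ q = a) := by
      by_contra hc
      push Not at hc
      apply hab
      rw [if_neg (fun h => hc.1 h.1 h.2), if_neg (fun h => hc.2 h.1 h.2)]
    rcases this with ⟨rfl, rfl⟩ | ⟨rfl, rfl⟩
    · abel
    · rw [edgeMat_comm q v, edgeMat_comm v p, edgeMat_comm q p]; abel
  induction l generalizing P with
  | nil => exact ⟨[], [], rfl, key P Q h⟩
  | cons w l ih =>
    by_cases hw : edgeMat P w p q = 0
    · obtain ⟨l₁, l₂, rfl, h2⟩ := ih w (by simpa [earMat, hw] using h)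
      refine ⟨w :: l₁, l₂, rfl, ?_⟩
      simp only [List.cons_append, earMat]
      rw [add_assoc, h2, ← add_assoc]
    · refine ⟨[], w :: l, rfl, ?_⟩
      simp only [List.nil_append, earMat]
      have := key P w hw
      calc _ = (edgeMat P v + edgeMat v w + edgeMat p q) + earMat w l Q := by abel
        _ = _ := by rw [this]; abel

/-- If the graph obtained by replacing a path `p, v, q` by an edge is made of ears, so is the
original graph. -/
lemma IsEarDecomposition.subdivide {M : Matrix V V ℕ} {p q v : V} {S : Finset V} {B : List V}
    {ears : List (Ear V)} (h : IsEarDecomposition (M + edgeMat p q) S B ears) (hv : v ∉ S) :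
    ∃ ears', ears'.map Ear.ends = ears.map Ear.ends ∧
      IsEarDecomposition (M + (edgeMat p v + edgeMat v q)) (insert v S) B ears' := by
  have hpq : ∃ e ∈ ears, e.mat p q ≠ 0 := by
    by_contra hc
    push Not at hc
    have h0 : (ears.map Ear.mat).sum p q = 0 := by
      clear h
      induction ears with
      | nil => rfl
      | cons e t ih =>
        rw [List.map_cons, List.sum_cons, Matrix.add_apply, hc e (by simp), zero_add]
        exact ih fun e he => hc e (by simp [he])
    rw [← h.eq_sum, Matrix.add_apply, edgeMat_apply] at h0
    simp at h0
  obtain ⟨e, he, hne⟩ := hpq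
  obtain ⟨s, t, rfl⟩ := List.append_of_mem he
  obtain ⟨l₁, l₂, hl, hmat⟩ := exists_earMat_insert v _ _ _ hne
  have hperm : (B ++ (s ++ ⟨e.first, l₁ ++ v :: l₂, e.last⟩ :: t).flatMap Ear.interior).Perm
      (v :: (B ++ (s ++ e :: t).flatMap Ear.interior)) := by
    simp only [List.flatMap_append, List.flatMap_cons, hl]
    rw [List.perm_iff_count]
    intro a
    simp only [List.count_append, List.count_cons]
    omega
  refine ⟨s ++ ⟨e.first, l₁ ++ v :: l₂, e.last⟩ :: t, by simp [Ear.ends], ?_, ?_, ?_, ?_⟩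
  · rw [hperm.nodup_iff, List.nodup_cons]
    exact ⟨fun hm => hv ((h.mem_iff v).1 hm), h.nodup⟩
  · intro x
    rw [hperm.mem_iff, List.mem_cons, h.mem_iff, Finset.mem_insert]
  · intro f hf
    simp only [List.mem_append, List.mem_cons] at hf
    rcases hf with hf | rfl | hf
    · exact h.ends_mem f (by simp [hf])
    · exact h.ends_mem e (by simp)
    · exact h.ends_mem f (by simp [hf])
  · have h1 := h.eq_sum
    simp only [List.map_append, List.map_cons, List.sum_append, List.sum_cons, Ear.mat] at h1 ⊢
    apply add_right_cancel (b := edgeMat p q)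
    calc _ = (M + edgeMat p q) + (edgeMat p v + edgeMat v q) := by abel
      _ = _ := by
        have h2 : ∀ a b c d : Matrix V V ℕ, a + (b + c) + d = a + c + (b + d) := by
          intros; abel
        rw [h1, h2, ← hmat]
        abel

/-- A symmetric matrix over `ℕ` supported on `S` that is the adjacency matrix of a connected
multigraph of rank two on `S` with all degrees at least two; the rank enters through the degree
sum, which is twice the number of edges. -/
structure IsRankTwoOn [Fintype V] (A : Matrix V V ℕ) (S : Finset V) : Prop where
  symm : ∀ x y, A x y = A y x
  even_diag : ∀ x, Even (A x x)
  supp : ∀ x y, A x y ≠ 0 → x ∈ S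
  two_le : ∀ x ∈ S, 2 ≤ ∑ y, A x y
  total : ∑ x ∈ S, ∑ y, A x y = 2 * S.card + 2
  conn : ∀ x ∈ S, ∀ y ∈ S, Relation.ReflTransGen (fun a b => A a b ≠ 0) x y

/-- A function to `ℕ` of total sum two is a sum of two indicator functions. -/
lemma exists_indicator_add_of_sum_eq_two [Fintype V] (f : V → ℕ) (h : ∑ y, f y = 2) :
    ∃ p q, ∀ y, f y = (if y = p then 1 else 0) + if y = q then 1 else 0 := by
  obtain ⟨p, hp⟩ : ∃ p, f p ≠ 0 := by
    by_contra hc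
    push Not at hc
    simp [hc] at h
  rw [← Finset.add_sum_erase _ _ (Finset.mem_univ p)] at h
  by_cases h2 : f p = 2
  · have h0 : ∑ y ∈ Finset.univ.erase p, f y = 0 := by omega
    rw [Finset.sum_eq_zero_iff] at h0
    refine ⟨p, p, fun y => ?_⟩
    by_cases hy : y = p
    · simp [hy, h2]
    · simp [hy, h0 y (by simp [hy])]
  · obtain ⟨q, hq, hq0⟩ : ∃ q ∈ Finset.univ.erase p, f q ≠ 0 := by
      by_contra hc
      push Not at hc
      rw [Finset.sum_eq_zero hc] at h
      omega
    have hqp : q ≠ p := (Finset.mem_erase.1 hq).1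
    rw [← Finset.add_sum_erase _ _ hq] at h
    have h0 : ∑ y ∈ (Finset.univ.erase p).erase q, f y = 0 := by omega
    rw [Finset.sum_eq_zero_iff] at h0
    refine ⟨p, q, fun y => ?_⟩
    by_cases hy : y = p
    · subst hy
      rw [if_pos rfl, if_neg (Ne.symm hqp)]
      omega
    · by_cases hy' : y = q
      · subst hy'
        rw [if_pos rfl, if_neg hqp]
        omega
      · simp [hy, hy', h0 y (by simp [hy, hy'])]

namespace IsRankTwoOn

variable [Fintype V] {A : Matrix V V ℕ} {S : Finset V}

/-- A vertex `v` of degree two can be suppressed: its two edges, to `p` and `q`, are replaced by a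
single edge from `p` to `q`, and the graph remains connected of rank two. -/
lemma exists_contract (h : IsRankTwoOn A S) {v : V} (hv : v ∈ S) (hd : ∑ y, A v y = 2) :
    ∃ (M : Matrix V V ℕ) (p q : V), A = M + (edgeMat p v + edgeMat v q) ∧
      IsRankTwoOn (M + edgeMat p q) (S.erase v) := by
  have hvv : A v v = 0 := by
    by_contra h0
    have h2 : A v v = 2 := by
      have := Finset.single_le_sum (f := fun y => A v y) (fun _ _ => Nat.zero_le _)
        (Finset.mem_univ v)
      have := h.even_diag v
      obtain ⟨k, hk⟩ := this
      omega
    rw [← Finset.add_sum_erase _ _ (Finset.mem_univ v), h2] at hd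
    have h3 : ∑ y ∈ Finset.univ.erase v, A v y = 0 := by omega
    rw [Finset.sum_eq_zero_iff] at h3
    -- A degree two vertex with a loop has no other neighbour, hence would be the only vertex.
    have hS : S = {v} := by
      refine Finset.eq_singleton_iff_unique_mem.2 ⟨hv, fun y hy => ?_⟩
      have := h.conn v hv y hy
      clear hy
      induction this with
      | refl => rfl
      | tail _ hbc ih =>
        subst ih
        by_contra hne
        exact hbc (h3 _ (by simp [hne]))
    have := h.total
    rw [hS] at this
    simp only [Finset.sum_singleton, Finset.card_singleton] at this
    rw [← Finset.add_sum_erase _ _ (Finset.mem_univ v), h2] at this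
    omega
  obtain ⟨p, q, hpq⟩ := exists_indicator_add_of_sum_eq_two _ hd
  have hp : p ≠ v := by
    rintro rfl
    rw [hpq p] at hvv
    simp at hvv
  have hq : q ≠ v := by
    rintro rfl
    rw [hpq q] at hvv
    simp at hvv
  let M : Matrix V V ℕ := fun x y => if x = v ∨ y = v then 0 else A x y
  have hM : ∀ x y, M x y = if x = v ∨ y = v then 0 else A x y := fun _ _ => rfl
  have hA : A = M + (edgeMat p v + edgeMat v q) := by
    ext x y
    simp only [Matrix.add_apply, edgeMat_apply, hM]
    by_cases hx : x = v
    · subst hx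
      simp [hpq, Ne.symm hp, Ne.symm hq]
    · by_cases hy : y = v
      · subst hy
        rw [h.symm, hpq]
        simp [hx, Ne.symm hp, Ne.symm hq]
      · simp [hx, hy]
  have hrow : ∀ x, x ≠ v → ∑ y, (M + edgeMat p q) x y = ∑ y, A x y := by
    intro x hx
    rw [hA]
    simp only [Matrix.add_apply, Finset.sum_add_distrib, sum_edgeMat, hx, if_false]
    omega
  have hvp : A p v ≠ 0 := by rw [h.symm, hpq]; simp
  have hvq : A q v ≠ 0 := by rw [h.symm, hpq]; simp
  have hpS : p ∈ S.erase v := Finset.mem_erase.2 ⟨hp, h.supp _ _ hvp⟩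
  have hqS : q ∈ S.erase v := Finset.mem_erase.2 ⟨hq, h.supp _ _ hvq⟩
  refine ⟨M, p, q, hA, ?_, ?_, ?_, ?_, ?_, ?_⟩
  · intro x y
    simp only [Matrix.add_apply, hM, h.symm x y, edgeMat_symm p q x y, or_comm]
  · intro x
    rw [Matrix.add_apply, hM]
    refine Even.add ?_ (even_edgeMat_diag p q x)
    split_ifs
    · exact Even.zero
    · exact h.even_diag x
  · intro x y hxy
    by_cases hx : x = p
    · exact hx ▸ hpS
    by_cases hx' : x = q
    · exact hx' ▸ hqS
    simp only [Matrix.add_apply, edgeMat_apply, hx, hx', false_and, if_false, add_zero, hM] at hxy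
    split_ifs at hxy with h1
    · exact absurd rfl hxy
    · push Not at h1
      exact Finset.mem_erase.2 ⟨h1.1, h.supp _ _ hxy⟩
  · intro x hx
    rw [Finset.mem_erase] at hx
    rw [hrow x hx.1]
    exact h.two_le x hx.2
  · rw [Finset.sum_congr rfl fun x hx => hrow x (Finset.mem_erase.1 hx).1,
      Finset.card_erase_of_mem hv]
    have := h.total
    rw [← Finset.add_sum_erase _ _ hv, hd] at this
    have := Finset.card_pos.2 ⟨v, hv⟩
    omega
  · -- A walk is carried over by moving `v` to `p`.
    intro x hx y hy
    rw [Finset.mem_erase] at hx hy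
    have hc := h.conn x hx.2 y hy.2
    have := Relation.ReflTransGen.lift' (p := fun a b => (M + edgeMat p q) a b ≠ 0)
      (fun a => if a = v then p else a) (fun a b hab => ?_) _ _ hc
    · simpa only [Function.onFun, if_neg hx.1, if_neg hy.1] using this
    · rw [Function.onFun]
      have hedge : (M + edgeMat p q) p q ≠ 0 := by simp [edgeMat_apply]
      have hedge' : (M + edgeMat p q) q p ≠ 0 := by simp [edgeMat_apply]
      by_cases ha : a = v
      · by_cases hb : b = v
        · subst ha hb
          exact absurd hvv hab
        · subst ha
          rw [hpq] at hab
          simp only [if_true, if_neg hb]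
          by_cases hbp : b = p
          · rw [hbp]
          · have hbq : b = q := by
              by_contra hbq
              simp [hbp, hbq] at hab
            rw [hbq]
            exact .single hedge
      · by_cases hb : b = v
        · subst hb
          rw [h.symm, hpq] at hab
          simp only [if_true, if_neg ha]
          by_cases hap : a = p
          · rw [hap]
          · have haq : a = q := by
              by_contra haq
              simp [hap, haq] at hab
            rw [haq]
            exact .single hedge'
        · simp only [if_neg ha, if_neg hb]
          refine .single ?_
          simp only [Matrix.add_apply, hM, ha, hb, or_self, if_false]
          omega

/-- A graph of rank two in which all degrees are at least three is a bouquet, a theta graph or a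
dumbbell. -/
lemma exists_of_three_le (h : IsRankTwoOn A S) (hd : ∀ x ∈ S, 3 ≤ ∑ y, A x y) :
    ∃ B ears, IsEarDecomposition A S B ears ∧ IsRankTwoShape B (ears.map Ear.ends) := by
  have hcard : S.card ≤ 2 := by
    have h1 := Finset.sum_le_sum hd
    rw [h.total, Finset.sum_const, smul_eq_mul] at h1
    omega
  have hrow : ∀ x, ∑ y, A x y = ∑ y ∈ S, A x y := by
    intro x
    symm
    apply Finset.sum_subset (Finset.subset_univ _)
    intro y _ hy
    by_contra hne
    rw [h.symm] at hne
    exact hy (h.supp _ _ hne)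
  have hzero : ∀ x y, x ∉ S ∨ y ∉ S → A x y = 0 := by
    rintro x y (hx | hy)
    · by_contra hne
      exact hx (h.supp _ _ hne)
    · by_contra hne
      rw [h.symm] at hne
      exact hy (h.supp _ _ hne)
  have htot := h.total
  interval_cases hc : S.card
  · rw [Finset.card_eq_zero] at hc
    simp [hc] at htot
  · obtain ⟨P, rfl⟩ := Finset.card_eq_one.1 hc
    simp only [hrow, Finset.sum_singleton] at htot
    refine ⟨[P], [⟨P, [], P⟩, ⟨P, [], P⟩], ⟨by simp, by simp, by simp, ?_⟩, .inl ⟨P, rfl, rfl⟩⟩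
    ext x y
    simp only [List.map_cons, List.map_nil, List.sum_cons, List.sum_nil, Ear.mat, earMat,
      Matrix.add_apply, edgeMat_apply, Matrix.zero_apply]
    by_cases hx : x = P
    · by_cases hy : y = P
      · simp [hx, hy, htot]
      · simp [hy, hzero x y (by simp [hy])]
    · simp [hx, hzero x y (by simp [hx])]
  · obtain ⟨P, Q, hPQ, rfl⟩ := Finset.card_eq_two.1 hc
    simp only [hrow, Finset.sum_pair hPQ] at htot hd
    have hdP := hd P (by simp)
    have hdQ := hd Q (by simp)
    have hsymm := h.symm P Q
    obtain ⟨i, hi⟩ := h.even_diag P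
    obtain ⟨j, hj⟩ := h.even_diag Q
    have hval : ∀ T : Matrix V V ℕ, (∀ x y, x ∉ ({P, Q} : Finset V) ∨ y ∉ ({P, Q} : Finset V) →
        T x y = 0) → A P P = T P P → A P Q = T P Q → A Q P = T Q P → A Q Q = T Q Q → A = T := by
      intro T hT h1 h2 h3 h4
      ext x y
      by_cases hx : x ∈ ({P, Q} : Finset V)
      · by_cases hy : y ∈ ({P, Q} : Finset V)
        · simp only [Finset.mem_insert, Finset.mem_singleton] at hx hy
          rcases hx with rfl | rfl <;> rcases hy with rfl | rfl <;> assumption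
        · rw [hzero x y (.inr hy), hT x y (.inr hy)]
      · rw [hzero x y (.inl hx), hT x y (.inl hx)]
    have hor : A P Q = 3 ∨ A P Q = 1 := by omega
    rcases hor with h3 | h1
    · refine ⟨[P, Q], [⟨P, [], Q⟩, ⟨P, [], Q⟩, ⟨P, [], Q⟩], ⟨by simp [hPQ], by simp, by simp, ?_⟩,
        .inr (.inl ⟨P, Q, rfl, rfl⟩)⟩
      simp only [List.map_cons, List.map_nil, List.sum_cons, List.sum_nil, Ear.mat, earMat]
      apply hval
      · intro x y hxy
        simp only [Finset.mem_insert, Finset.mem_singleton, not_or] at hxy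
        simp only [Matrix.add_apply, edgeMat_apply, Matrix.zero_apply]
        rcases hxy with ⟨h5, h6⟩ | ⟨h5, h6⟩ <;> simp [h5, h6]
      all_goals
        simp only [Matrix.add_apply, edgeMat_apply, Matrix.zero_apply]
        simp [hPQ, Ne.symm hPQ]
        omega
    · refine ⟨[P, Q], [⟨P, [], P⟩, ⟨P, [], Q⟩, ⟨Q, [], Q⟩], ⟨by simp [hPQ], by simp, by simp, ?_⟩,
        .inr (.inr ⟨P, Q, rfl, rfl⟩)⟩
      simp only [List.map_cons, List.map_nil, List.sum_cons, List.sum_nil, Ear.mat, earMat]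
      apply hval
      · intro x y hxy
        simp only [Finset.mem_insert, Finset.mem_singleton, not_or] at hxy
        simp only [Matrix.add_apply, edgeMat_apply, Matrix.zero_apply]
        rcases hxy with ⟨h5, h6⟩ | ⟨h5, h6⟩ <;> simp [h5, h6]
      all_goals
        simp only [Matrix.add_apply, edgeMat_apply, Matrix.zero_apply]
        simp [hPQ, Ne.symm hPQ]
        omega

/-- A connected graph of rank two without vertices of degree one is a subdivision of a bouquet, a
theta graph or a dumbbell. -/
theorem exists_earDecomposition (h : IsRankTwoOn A S) :
    ∃ B ears, IsEarDecomposition A S B ears ∧ IsRankTwoShape B (ears.map Ear.ends) := by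
  induction hn : S.card using Nat.strong_induction_on generalizing A S with
  | _ n ih =>
    by_cases hd : ∀ x ∈ S, 3 ≤ ∑ y, A x y
    · exact h.exists_of_three_le hd
    · push Not at hd
      obtain ⟨v, hv, hlt⟩ := hd
      have h2 : ∑ y, A v y = 2 := by
        have := h.two_le v hv
        omega
      obtain ⟨M, p, q, rfl, h'⟩ := h.exists_contract hv h2
      obtain ⟨B, ears, hdec, hshape⟩ := ih _ (hn ▸ Finset.card_erase_lt_of_mem hv) h' rfl
      obtain ⟨ears', hends, hdec'⟩ := hdec.subdivide (Finset.notMem_erase v S)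
      rw [Finset.insert_erase hv] at hdec'
      exact ⟨B, ears', hdec', hends ▸ hshape⟩

end IsRankTwoOn

end Ears

/-! ### Elimination of vertices of degree two in the determinant -/

section Determinant

variable {V K : Type*} [DecidableEq V] [Field K]

/-- The contribution to the normalised matrix `(I - A u + Q u ^ 2) / (1 - u ^ 2)` of a path from
`p` to `q` on which `t` is `u` to the power of the length. Its interior vertices are thought of as
eliminated. -/
def linkMat (t : K) (p q : V) : Matrix V V K := fun x y =>
  (1 - t ^ 2)⁻¹ * (t ^ 2 * ((Pi.single p 1 : V → K) x * (Pi.single p 1 : V → K) y +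
    (Pi.single q 1 : V → K) x * (Pi.single q 1 : V → K) y) -
    t * ((Pi.single p 1 : V → K) x * (Pi.single q 1 : V → K) y +
    (Pi.single q 1 : V → K) x * (Pi.single p 1 : V → K) y))

/-- The sum of the matrices `linkMat` of the steps of a path from `P` to `Q` with the given
interior vertices; the first step has weight `t` and all others have weight `u`. -/
def earLinkMat (u : K) : K → V → List V → V → Matrix V V K
  | t, P, [], Q => linkMat t P Q
  | t, P, v :: l, Q => linkMat t P v + earLinkMat u u v l Q

lemma linkMat_apply_eq_zero_left (t : K) {p q x : V} (hp : p ≠ x) (hq : q ≠ x) (y : V) :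
    linkMat t p q x y = 0 := by
  simp [linkMat, Pi.single_apply, hp.symm, hq.symm]

lemma linkMat_apply_eq_zero_right (t : K) {p q y : V} (hp : p ≠ y) (hq : q ≠ y) (x : V) :
    linkMat t p q x y = 0 := by
  simp [linkMat, Pi.single_apply, hp.symm, hq.symm]

lemma earLinkMat_apply_eq_zero (u t : K) {P Q x : V} {l : List V} (hP : P ≠ x) (hQ : Q ≠ x)
    (hl : x ∉ l) (y : V) : earLinkMat u t P l Q x y = 0 ∧ earLinkMat u t P l Q y x = 0 := by
  induction l generalizing t P with
  | nil => exact ⟨linkMat_apply_eq_zero_left t hP hQ y, linkMat_apply_eq_zero_right t hP hQ y⟩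
  | cons v l ih =>
    simp only [List.mem_cons, not_or] at hl
    have := ih u (Ne.symm hl.1) hl.2
    simp only [earLinkMat, Matrix.add_apply, this.1, this.2,
      linkMat_apply_eq_zero_left t hP (Ne.symm hl.1),
      linkMat_apply_eq_zero_right t hP (Ne.symm hl.1), add_zero, and_self]

variable [Fintype V]

/-- Elimination of the row and column of a pivot `v`, in a form that keeps the size of the matrix:
the eliminated vertex stays behind with a unit entry on the diagonal. -/
lemma det_add_smul_vecMulVec (N : Matrix V V K) {v : V} {w : V → K} (d : K) (hw : w v = 0)
    (hrow : ∀ y, N v y = 0) (hcol : ∀ x, N x v = 0) :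
    (N + d • Matrix.vecMulVec (Pi.single v 1 - w) (Pi.single v 1 - w)).det =
      d * (N + Matrix.vecMulVec (Pi.single v 1) (Pi.single v 1)).det := by
  set e : V → K := Pi.single v 1 with he
  have h1 : (1 - Matrix.vecMulVec w e).det = 1 := by
    have := Matrix.det_one_add_replicateCol_mul_replicateRow (ι := Unit) (-w) e
    rw [← Matrix.vecMulVec_eq, Matrix.neg_vecMulVec, ← sub_eq_add_neg] at this
    rw [this]
    simp [he, hw]
  have h2 : (N + d • Matrix.vecMulVec e e).det = d * (N + Matrix.vecMulVec e e).det := by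
    have : N + d • Matrix.vecMulVec e e = (N + Matrix.vecMulVec e e) *
        Matrix.diagonal (fun y => if y = v then d else 1) := by
      ext x y
      rw [Matrix.mul_diagonal]
      by_cases hy : y = v
      · subst hy
        simp [Matrix.vecMulVec_apply, he, hcol, mul_comm]
      · simp [Matrix.vecMulVec_apply, he, hy]
    rw [this, Matrix.det_mul, Matrix.det_diagonal, mul_comm]
    simp
  have heN : Matrix.vecMul e N = 0 := by
    ext y; simp [he, hrow]
  have hNe : Matrix.mulVec N e = 0 := by
    ext y; simp [he, hcol]
  have hee : e ⬝ᵥ e = 1 := by simp [he]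
  have h3 : N + d • Matrix.vecMulVec (e - w) (e - w) =
      (1 - Matrix.vecMulVec w e) * (N + d • Matrix.vecMulVec e e) *
        (1 - Matrix.vecMulVec w e).transpose := by
    have h4 : (1 - Matrix.vecMulVec w e) * (N + d • Matrix.vecMulVec e e) =
        N + d • Matrix.vecMulVec (e - w) e := by
      rw [sub_mul, one_mul, mul_add, Matrix.vecMulVec_mul, heN, Matrix.vecMulVec_zero, zero_add,
        mul_smul_comm, Matrix.vecMulVec_mul_vecMulVec, hee, one_smul, Matrix.sub_vecMulVec,
        smul_sub]
      abel
    rw [h4, Matrix.transpose_sub, Matrix.transpose_one, Matrix.transpose_vecMulVec, mul_sub,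
      mul_one, add_mul, Matrix.mul_vecMulVec, hNe, Matrix.zero_vecMulVec, zero_add,
      smul_mul_assoc, Matrix.vecMulVec_mul_vecMulVec, hee, one_smul, Matrix.vecMulVec_sub,
      smul_sub]
    abel
  rw [h3, Matrix.det_mul, Matrix.det_mul, Matrix.det_transpose, h1, h2, one_mul, mul_one]

/-- Eliminating a vertex of degree two merges its two links, and their weights multiply. -/
lemma det_one_add_linkMat_add_linkMat (M : Matrix V V K) {p q v : V} {s t : K} (hp : p ≠ v)
    (hq : q ≠ v) (hrow : ∀ y, M v y = 0) (hcol : ∀ x, M x v = 0) (hs : 1 - s ^ 2 ≠ 0)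
    (ht : 1 - t ^ 2 ≠ 0) (hst : 1 - (s * t) ^ 2 ≠ 0) :
    (1 - s ^ 2) * (1 - t ^ 2) * (1 + M + (linkMat s p v + linkMat t v q)).det =
      (1 - (s * t) ^ 2) * (1 + M + linkMat (s * t) p q).det := by
  have hst' : 1 - s ^ 2 * t ^ 2 ≠ 0 := by rwa [← mul_pow]
  -- The Schur complement: `d` is the diagonal entry at `v`, and `-d * w` its off-diagonal column.
  set d : K := (1 - s ^ 2 * t ^ 2) / ((1 - s ^ 2) * (1 - t ^ 2)) with hd
  set w : V → K := fun x => (s * (1 - t ^ 2) / (1 - s ^ 2 * t ^ 2)) * (Pi.single p 1 : V → K) x +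
    (t * (1 - s ^ 2) / (1 - s ^ 2 * t ^ 2)) * (Pi.single q 1 : V → K) x with hwdef
  have hw : w v = 0 := by simp [hwdef, hp.symm, hq.symm]
  set e : V → K := Pi.single v 1 with he
  set N : Matrix V V K := 1 + M + linkMat (s * t) p q - Matrix.vecMulVec e e with hN
  have hone : ∀ x y, x = v ∨ y = v → (1 : Matrix V V K) x y = e x * e y := by
    rintro x y (rfl | rfl)
    · rw [Matrix.one_apply]
      by_cases hy : x = y
      · subst hy; simp [he]
      · simp [he, hy, Ne.symm hy]
    · rw [Matrix.one_apply]
      by_cases hy : x = y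
      · subst hy; simp [he]
      · simp [he, hy]
  have h1 := det_add_smul_vecMulVec N d hw
    (by intro y; simp [hN, hrow, hone, linkMat_apply_eq_zero_left _ hp hq, Matrix.vecMulVec_apply])
    (by intro y; simp [hN, hcol, hone, linkMat_apply_eq_zero_right _ hp hq, Matrix.vecMulVec_apply])
  have h2 : 1 + M + (linkMat s p v + linkMat t v q) =
      N + d • Matrix.vecMulVec (e - w) (e - w) := by
    ext x y
    simp only [hN, hd, hwdef, Matrix.add_apply, Matrix.sub_apply, Matrix.smul_apply, smul_eq_mul,
      Matrix.vecMulVec_apply, linkMat, Pi.sub_apply, ← he]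
    generalize (1 : Matrix V V K) x y = i
    generalize M x y = m
    generalize e x = a
    generalize e y = a'
    generalize (Pi.single p 1 : V → K) x = b
    generalize (Pi.single p 1 : V → K) y = b'
    generalize (Pi.single q 1 : V → K) x = c
    generalize (Pi.single q 1 : V → K) y = c'
    rw [mul_pow]
    field_simp
    ring
  rw [h2, h1, hN, sub_add_cancel, hd, mul_pow]
  field_simp

/-- Eliminating all interior vertices of a path. -/
lemma det_one_add_earLinkMat {u : K} (hu : ∀ k : ℕ, k ≠ 0 → 1 - (u ^ k) ^ 2 ≠ 0)
    (M : Matrix V V K) (l : List V) (P Q : V) (j : ℕ) (hj : j ≠ 0) (hnd : l.Nodup) (hP : P ∉ l)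
    (hQ : Q ∉ l) (hM : ∀ v ∈ l, ∀ y, M v y = 0 ∧ M y v = 0) :
    (1 - (u ^ j) ^ 2) * (1 - u ^ 2) ^ l.length * (1 + M + earLinkMat u (u ^ j) P l Q).det =
      (1 - (u ^ (j + l.length)) ^ 2) * (1 + M + linkMat (u ^ (j + l.length)) P Q).det := by
  induction l generalizing j with
  | nil => simp [earLinkMat]
  | cons v l ih =>
    simp only [List.nodup_cons, List.mem_cons, not_or] at hnd hP hQ
    -- Split off the first link of the remaining path, the only one at `v`.
    obtain ⟨w, R, hwv, hR, hw⟩ : ∃ (w : V) (R : Matrix V V K), w ≠ v ∧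
        (∀ y, R v y = 0 ∧ R y v = 0) ∧
        ∀ t x, earLinkMat u t x l Q = R + linkMat t x w := by
      cases l with
      | nil => exact ⟨Q, 0, hQ.1, by simp, by simp [earLinkMat]⟩
      | cons w l =>
        simp only [List.mem_cons, not_or] at hnd
        exact ⟨w, earLinkMat u u w l Q, Ne.symm hnd.1.1,
          earLinkMat_apply_eq_zero u u (Ne.symm hnd.1.1) hQ.1 hnd.1.2,
          fun t x => add_comm _ _⟩
    have h1 := det_one_add_linkMat_add_linkMat (M + R) (p := P) (q := w) (v := v) (s := u ^ j)
      (t := u) hP.1 hwv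
      (fun y => by simp [(hM v (by simp) y).1, (hR y).1])
      (fun y => by simp [(hM v (by simp) y).2, (hR y).2])
      (hu j hj) (by simpa using hu 1 one_ne_zero) (by rw [← pow_succ]; exact hu _ (by omega))
    have h2 := ih (j + 1) (by omega) hnd.2 hP.2 hQ.2 (fun v hv => hM v (by simp [hv]))
    rw [← pow_succ] at h1
    have h3 : 1 + M + earLinkMat u (u ^ (j + 1)) P l Q =
        1 + (M + R) + linkMat (u ^ (j + 1)) P w := by rw [hw]; abel
    have h4 : 1 + M + earLinkMat u (u ^ j) P (v :: l) Q =
        1 + (M + R) + (linkMat (u ^ j) P v + linkMat u v w) := by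
      rw [earLinkMat, hw]; abel
    rw [h3] at h2
    rw [h4, List.length_cons, show j + (l.length + 1) = j + 1 + l.length by omega, ← h2, pow_succ]
    linear_combination (1 - u ^ 2) ^ l.length * h1

/-- The number of edges of an ear. -/
def Ear.length {V : Type*} (e : Ear V) : ℕ := e.interior.length + 1

/-- Eliminating the interior vertices of all ears. -/
lemma det_one_add_sum_earLinkMat {u : K} (hu : ∀ k : ℕ, k ≠ 0 → 1 - (u ^ k) ^ 2 ≠ 0)
    (ears : List (Ear V)) (M : Matrix V V K) (B : List V)
    (hnd : (B ++ ears.flatMap Ear.interior).Nodup) (hB : ∀ e ∈ ears, e.first ∈ B ∧ e.last ∈ B)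
    (hM : ∀ v ∈ ears.flatMap Ear.interior, ∀ y, M v y = 0 ∧ M y v = 0) :
    (1 - u ^ 2) ^ (ears.map Ear.length).sum *
        (1 + M + (ears.map fun e => earLinkMat u u e.first e.interior e.last).sum).det =
      (ears.map fun e => 1 - (u ^ e.length) ^ 2).prod *
        (1 + M + (ears.map fun e => linkMat (u ^ e.length) e.first e.last).sum).det := by
  induction ears generalizing M with
  | nil => simp
  | cons e ears ih =>
    obtain ⟨hBnd, hnd', hdis⟩ := List.nodup_append'.1 hnd
    rw [List.flatMap_cons] at hnd' hdis hM
    obtain ⟨hend, hrnd, hdis'⟩ := List.nodup_append'.1 hnd'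
    have hBe : ∀ b ∈ B, b ∉ e.interior := fun b hb hbe => hdis hb (by simp [hbe])
    have hBr : ∀ b ∈ B, b ∉ ears.flatMap Ear.interior := fun b hb hbe =>
      hdis hb (List.mem_append_right _ hbe)
    have he := hB e (by simp)
    have hrest : ∀ v ∈ e.interior, ∀ y,
        (ears.map fun e => earLinkMat u u e.first e.interior e.last).sum v y = 0 ∧
        (ears.map fun e => earLinkMat u u e.first e.interior e.last).sum y v = 0 := by
      intro v hv y
      have hvr : v ∉ ears.flatMap Ear.interior := fun h => hdis' hv h
      have hB' : ∀ f ∈ ears, f.first ∈ B ∧ f.last ∈ B := fun f hf => hB f (by simp [hf])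
      clear ih hB hnd hM hnd' hdis hdis' hrnd hBr
      induction ears with
      | nil => simp
      | cons f r ih =>
        rw [List.flatMap_cons, List.mem_append, not_or] at hvr
        have h1 := ih hvr.2 fun g hg => hB' g (by simp [hg])
        have hf := hB' f (by simp)
        have h2 := earLinkMat_apply_eq_zero u u (P := f.first) (Q := f.last) (x := v)
          (fun h => hBe _ hf.1 (h ▸ hv)) (fun h => hBe _ hf.2 (h ▸ hv)) hvr.1 y
        simp [h1.1, h1.2, h2.1, h2.2]
    have h1 := det_one_add_earLinkMat hu
      (M + (ears.map fun e => earLinkMat u u e.first e.interior e.last).sum)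
      e.interior e.first e.last 1 one_ne_zero hend (hBe _ he.1) (hBe _ he.2)
      (fun v hv y => by
        simp [(hM v (by simp [hv]) y).1, (hM v (by simp [hv]) y).2, (hrest v hv y).1,
          (hrest v hv y).2])
    have h2 := ih (M + linkMat (u ^ e.length) e.first e.last)
      (List.nodup_append'.2 ⟨hBnd, hrnd, fun b hb hbe => hBr b hb hbe⟩)
      (fun f hf => hB f (by simp [hf]))
      (fun v hv y => by
        have hv1 : e.first ≠ v := fun h => hBr _ he.1 (h ▸ hv)
        have hv2 : e.last ≠ v := fun h => hBr _ he.2 (h ▸ hv)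
        have := hM v (List.mem_append_right _ hv) y
        simp [this.1, this.2, linkMat_apply_eq_zero_left _ hv1 hv2,
          linkMat_apply_eq_zero_right _ hv1 hv2])
    simp only [List.map_cons, List.sum_cons, List.prod_cons]
    rw [add_comm 1 e.interior.length] at h1
    change _ = (1 - (u ^ e.length) ^ 2) * (1 + _ + linkMat (u ^ e.length) _ _).det at h1
    rw [pow_one] at h1
    have e1 : ∀ X Y : Matrix V V K, 1 + M + (X + Y) = 1 + (M + Y) + X := by intros; abel
    have e2 : ∀ X Y : Matrix V V K, 1 + M + (X + Y) = 1 + (M + X) + Y := by intros; abel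
    have e3 : ∀ X Y : Matrix V V K, 1 + (M + Y) + X = 1 + (M + X) + Y := by intros; abel
    rw [e3 (linkMat (u ^ e.length) e.first e.last)] at h1
    rw [e1, e2, pow_add, mul_assoc ((1 - (u ^ e.length) ^ 2)), ← h2]
    rw [show (1 - u ^ 2) ^ e.length = (1 - u ^ 2) * (1 - u ^ 2) ^ e.interior.length from
      pow_succ' _ _]
    linear_combination (1 - u ^ 2) ^ (ears.map Ear.length).sum * h1

/-- The matrix `I - A u + Q u ^ 2` at an element `u` of a field; the degrees are the row sums
of `A`. -/
def fieldZetaMatrix (A : Matrix V V ℕ) (u : K) : Matrix V V K :=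
  1 - u • A.map (fun k => (k : K)) +
    u ^ 2 • (Matrix.diagonal (fun x => ((∑ y, A x y : ℕ) : K)) - 1)

/-- The part of `I - A u + Q u ^ 2` that is additive in the set of edges. -/
def lapMatrix (u : K) : Matrix V V ℕ →+ Matrix V V K where
  toFun A := u ^ 2 • Matrix.diagonal (fun x => ((∑ y, A x y : ℕ) : K)) - u • A.map (fun k => (k : K))
  map_zero' := by ext; simp
  map_add' A B := by
    ext x y
    simp only [Matrix.add_apply, Matrix.sub_apply, Matrix.smul_apply, Matrix.map_apply,
      Matrix.diagonal_apply, Finset.sum_add_distrib, smul_eq_mul]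
    split_ifs <;> push_cast <;> ring

lemma fieldZetaMatrix_eq (A : Matrix V V ℕ) (u : K) :
    fieldZetaMatrix A u = (1 - u ^ 2) • (1 : Matrix V V K) + lapMatrix u A := by
  simp only [fieldZetaMatrix, lapMatrix, AddMonoidHom.coe_mk, ZeroHom.coe_mk, smul_sub, sub_smul,
    one_smul]
  abel

lemma lapMatrix_edgeMat {u : K} (hu : 1 - u ^ 2 ≠ 0) (p q : V) :
    lapMatrix u (edgeMat p q) = (1 - u ^ 2) • linkMat u p q := by
  ext x y
  simp only [lapMatrix, AddMonoidHom.coe_mk, ZeroHom.coe_mk, Matrix.sub_apply, Matrix.smul_apply,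
    Matrix.map_apply, Matrix.diagonal_apply, sum_edgeMat, linkMat, smul_eq_mul, Pi.single_apply]
  simp only [edgeMat_apply]
  rw [mul_inv_cancel_left₀ hu]
  push_cast
  by_cases hxy : x = y
  · subst hxy
    by_cases h1 : x = p <;> by_cases h2 : x = q <;> simp [h1, h2]
  · by_cases h1 : x = p <;> by_cases h2 : x = q <;> by_cases h3 : y = p <;> by_cases h4 : y = q <;>
      simp_all

lemma lapMatrix_earMat {u : K} (hu : 1 - u ^ 2 ≠ 0) (P : V) (l : List V) (Q : V) :
    lapMatrix u (earMat P l Q) = (1 - u ^ 2) • earLinkMat u u P l Q := by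
  induction l generalizing P with
  | nil => exact lapMatrix_edgeMat hu P Q
  | cons v l ih => rw [earMat, map_add, lapMatrix_edgeMat hu, ih, earLinkMat, smul_add]

/-- The zeta function of a graph made of ears is computed on the branch vertices. The assumption on
the number of ears says that the rank is two; the powers of `1 - u ^ 2`, one for each edge, then
cancel against the factor `1 - u ^ 2` of the zeta function and the scaling of the matrix. -/
lemma det_fieldZetaMatrix {u : K} (hu : ∀ k : ℕ, k ≠ 0 → 1 - (u ^ k) ^ 2 ≠ 0)
    {A : Matrix V V ℕ} {B : List V} {ears : List (Ear V)}
    (h : IsEarDecomposition A Finset.univ B ears) (hlen : ears.length = B.length + 1) :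
    (1 - u ^ 2) * (fieldZetaMatrix A u).det =
      (ears.map fun e => 1 - (u ^ e.length) ^ 2).prod *
        (1 + (ears.map fun e => linkMat (u ^ e.length) e.first e.last).sum).det := by
  have hu1 : 1 - u ^ 2 ≠ 0 := by simpa using hu 1 one_ne_zero
  have hcard : (ears.map Ear.length).sum = Fintype.card V + 1 := by
    have h1 : Fintype.card V = (B ++ ears.flatMap Ear.interior).length := by
      rw [← Finset.card_univ, ← List.toFinset_card_of_nodup h.nodup]
      congr 1
      ext x
      rw [List.mem_toFinset, h.mem_iff]
    have h2 : (ears.map Ear.length).sum = ears.length + (ears.flatMap Ear.interior).length := by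
      clear h h1 hlen
      induction ears with
      | nil => rfl
      | cons e r ih =>
        simp only [List.map_cons, List.sum_cons, ih, List.flatMap_cons, List.length_cons,
          List.length_append, Ear.length]
        omega
    rw [h1, h2, List.length_append, hlen]
    omega
  have h1 := det_one_add_sum_earLinkMat hu ears 0 B h.nodup h.ends_mem (by simp)
  rw [add_zero] at h1
  rw [← h1, hcard, pow_succ' (1 - u ^ 2)]
  have h2 : fieldZetaMatrix A u = (1 - u ^ 2) •
      (1 + (ears.map fun e => earLinkMat u u e.first e.interior e.last).sum) := by
    rw [fieldZetaMatrix_eq, h.eq_sum, map_list_sum, smul_add, List.smul_sum, List.map_map,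
      List.map_map]
    congr 3
    ext e : 1
    exact lapMatrix_earMat hu1 _ _ _
  rw [h2, Matrix.det_smul, mul_assoc]

/-- A perturbation of the identity supported on the rows and columns in the image of `f`. -/
lemma det_one_add_submatrix_sum {ι : Type*} [Fintype ι] [DecidableEq ι] (f : ι → V)
    (hf : Function.Injective f) (T : Matrix ι ι K) :
    (1 + Matrix.of fun x y => ∑ i, ∑ j, (Pi.single (f i) 1 : V → K) x * T i j *
      (Pi.single (f j) 1 : V → K) y).det = (1 + T).det := by
  -- The perturbation is `C * T * Cᵀ` with orthonormal columns in `C`.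
  set C : Matrix V ι K := Matrix.of fun x i => (Pi.single (f i) 1 : V → K) x with hC
  have h1 : C.transpose * C = 1 := by
    ext i j
    simp [hC, Matrix.mul_apply, Matrix.one_apply, Pi.single_apply, hf.eq_iff, eq_comm]
  have h2 : (Matrix.of fun x y => ∑ i, ∑ j, (Pi.single (f i) 1 : V → K) x * T i j *
      (Pi.single (f j) 1 : V → K) y) = C * (T * C.transpose) := by
    ext x y
    simp only [hC, Matrix.mul_apply, Matrix.of_apply, Matrix.transpose_apply, Finset.mul_sum,
      mul_assoc]
  rw [h2, Matrix.det_one_add_mul_comm, Matrix.mul_assoc, h1, Matrix.mul_one]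

lemma det_one_add_linkMat_bouquet (P : V) {x y : K} (hx : 1 - x ^ 2 ≠ 0) (hy : 1 - y ^ 2 ≠ 0) :
    (1 - x ^ 2) * (1 - y ^ 2) * (1 + (linkMat x P P + linkMat y P P)).det =
      (1 - x) ^ 2 * (1 - y) ^ 2 - 4 * (x * y) * ((1 - x) * (1 - y)) := by
  have h := det_one_add_submatrix_sum (K := K) (fun _ : Fin 1 => P)
    (Function.injective_of_subsingleton _)
    !![(1 - x ^ 2)⁻¹ * (2 * x ^ 2 - 2 * x) + (1 - y ^ 2)⁻¹ * (2 * y ^ 2 - 2 * y)]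
  have h2 : linkMat x P P + linkMat y P P = Matrix.of fun z w => ∑ i : Fin 1, ∑ j : Fin 1,
      (Pi.single P 1 : V → K) z * (!![(1 - x ^ 2)⁻¹ * (2 * x ^ 2 - 2 * x) +
        (1 - y ^ 2)⁻¹ * (2 * y ^ 2 - 2 * y)] : Matrix (Fin 1) (Fin 1) K) i j *
          (Pi.single P 1 : V → K) w := by
    ext z w
    simp only [Matrix.add_apply, linkMat, Matrix.of_apply, Fin.sum_univ_one]
    simp only [Fin.isValue, Matrix.cons_val_fin_one]
    ring
  rw [h2, h, Matrix.det_fin_one]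
  simp only [Matrix.add_apply, Matrix.one_apply_eq, Matrix.of_apply,
    Matrix.cons_val_fin_one]
  field_simp
  ring

lemma det_one_add_linkMat_theta {P Q : V} (hPQ : P ≠ Q) {x y z : K} (hx : 1 - x ^ 2 ≠ 0)
    (hy : 1 - y ^ 2 ≠ 0) (hz : 1 - z ^ 2 ≠ 0) :
    (1 - x ^ 2) * (1 - y ^ 2) * (1 - z ^ 2) *
        (1 + (linkMat x P Q + linkMat y P Q + linkMat z P Q)).det =
      (1 - x * y - x * z - y * z) ^ 2 - 4 * (x * y * z) ^ 2 := by
  set a : K := (1 - x ^ 2)⁻¹ * x ^ 2 + (1 - y ^ 2)⁻¹ * y ^ 2 + (1 - z ^ 2)⁻¹ * z ^ 2 with ha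
  set c : K := -((1 - x ^ 2)⁻¹ * x + (1 - y ^ 2)⁻¹ * y + (1 - z ^ 2)⁻¹ * z) with hc
  have h := det_one_add_submatrix_sum (K := K) ![P, Q]
    (by intro i j; fin_cases i <;> fin_cases j <;> simp [hPQ, hPQ.symm]) !![a, c; c, a]
  have h2 : linkMat x P Q + linkMat y P Q + linkMat z P Q =
      Matrix.of fun v w => ∑ i : Fin 2, ∑ j : Fin 2,
      (Pi.single (![P, Q] i) 1 : V → K) v * !![a, c; c, a] i j *
          (Pi.single (![P, Q] j) 1 : V → K) w := by
    ext v w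
    simp only [Matrix.add_apply, linkMat, Matrix.of_apply, Fin.sum_univ_two]
    simp only [Fin.isValue, Matrix.cons_val_zero, Matrix.cons_val_one, Matrix.cons_val_fin_one]
    rw [ha, hc]
    ring
  rw [h2, h, Matrix.det_fin_two]
  simp only [Matrix.add_apply, Matrix.one_apply, Matrix.of_apply, Matrix.cons_val_zero,
    Matrix.cons_val_one, Matrix.cons_val_fin_one]
  simp only [if_true, zero_ne_one, one_ne_zero, if_false]
  rw [ha, hc]
  field_simp
  ring

lemma det_one_add_linkMat_dumbbell {P Q : V} (hPQ : P ≠ Q) {x y z : K} (hx : 1 - x ^ 2 ≠ 0)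
    (hy : 1 - y ^ 2 ≠ 0) (hz : 1 - z ^ 2 ≠ 0) :
    (1 - x ^ 2) * (1 - z ^ 2) * (1 - y ^ 2) *
        (1 + (linkMat x P P + linkMat z P Q + linkMat y Q Q)).det =
      (1 - x) ^ 2 * (1 - y) ^ 2 - 4 * (x * y * z ^ 2) * ((1 - x) * (1 - y)) := by
  set a : K := (1 - x ^ 2)⁻¹ * (2 * x ^ 2 - 2 * x) + (1 - z ^ 2)⁻¹ * z ^ 2 with ha
  set b : K := (1 - y ^ 2)⁻¹ * (2 * y ^ 2 - 2 * y) + (1 - z ^ 2)⁻¹ * z ^ 2 with hb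
  set c : K := -((1 - z ^ 2)⁻¹ * z) with hc
  have h := det_one_add_submatrix_sum (K := K) ![P, Q]
    (by intro i j; fin_cases i <;> fin_cases j <;> simp [hPQ, hPQ.symm]) !![a, c; c, b]
  have h2 : linkMat x P P + linkMat z P Q + linkMat y Q Q =
      Matrix.of fun v w => ∑ i : Fin 2, ∑ j : Fin 2,
      (Pi.single (![P, Q] i) 1 : V → K) v * !![a, c; c, b] i j *
          (Pi.single (![P, Q] j) 1 : V → K) w := by
    ext v w
    simp only [Matrix.add_apply, linkMat, Matrix.of_apply, Fin.sum_univ_two]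
    simp only [Fin.isValue, Matrix.cons_val_zero, Matrix.cons_val_one, Matrix.cons_val_fin_one]
    rw [ha, hb, hc]
    ring
  rw [h2, h, Matrix.det_fin_two]
  simp only [Matrix.add_apply, Matrix.one_apply, Matrix.of_apply, Matrix.cons_val_zero,
    Matrix.cons_val_one, Matrix.cons_val_fin_one]
  simp only [if_true, zero_ne_one, one_ne_zero, if_false]
  rw [ha, hb, hc]
  field_simp
  ring

end Determinant

/-! ### The zeta polynomials determine the lengths -/

section Polynomials

open Polynomial

/-- The polynomial `(1 - u ^ a) * (1 - u ^ b)`. -/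
noncomputable def loopsPoly (a b : ℕ) : ℂ[X] := (1 - X ^ a) * (1 - X ^ b)

/-- The reciprocal of the zeta function of the dumbbell with loops of lengths `a` and `b` joined by
a path of length `c`; for `c = 0` this is the bouquet. -/
noncomputable def dumbbellPoly (a b c : ℕ) : ℂ[X] :=
  loopsPoly a b ^ 2 - 4 * X ^ (a + b + c + c) * loopsPoly a b

/-- The polynomial `1` minus the sum of `u ^ l` over the lengths `l` of the cycles of a theta
graph. -/
noncomputable def cyclesPoly (a b c : ℕ) : ℂ[X] := 1 - X ^ (a + b) - X ^ (a + c) - X ^ (b + c)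

/-- The reciprocal of the zeta function of the theta graph with paths of lengths `a`, `b`, `c`. -/
noncomputable def thetaPoly (a b c : ℕ) : ℂ[X] :=
  cyclesPoly a b c ^ 2 - 4 * X ^ (2 * (a + b + c))

lemma natDegree_sub_C_mul_X_pow {p : ℂ[X]} {n : ℕ} {k : ℂ} (hk : k ≠ 0) (h : p.natDegree < n) :
    (p - C k * X ^ n).natDegree = n := by
  rw [natDegree_sub_eq_right_of_natDegree_lt, natDegree_C_mul_X_pow _ _ hk]
  rwa [natDegree_C_mul_X_pow _ _ hk]

lemma natDegree_one_sub_X_pow_sub_X_pow_le (a b : ℕ) :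
    (1 - X ^ a - X ^ b : ℂ[X]).natDegree ≤ max a b := by
  have := natDegree_sub_le_of_le (natDegree_sub_le_of_le (natDegree_one (R := ℂ)).le
    (natDegree_X_pow_le (R := ℂ) a)) (natDegree_X_pow_le (R := ℂ) b)
  rwa [Nat.zero_max] at this

lemma loopsPoly_eq (a b : ℕ) : loopsPoly a b = 1 - X ^ a - X ^ b - C (-1) * X ^ (a + b) := by
  rw [loopsPoly, C_neg, C_1, pow_add]; ring

lemma natDegree_loopsPoly {a b : ℕ} (ha : a ≠ 0) (hb : b ≠ 0) :
    (loopsPoly a b).natDegree = a + b := by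
  rw [loopsPoly_eq]
  refine natDegree_sub_C_mul_X_pow (by norm_num) ?_
  have := natDegree_one_sub_X_pow_sub_X_pow_le a b
  omega

lemma natDegree_dumbbellPoly {a b : ℕ} (ha : a ≠ 0) (hb : b ≠ 0) (c : ℕ) :
    (dumbbellPoly a b c).natDegree = 2 * (a + b + c) := by
  have h1 : dumbbellPoly a b c =
      loopsPoly a b * (loopsPoly a b - C 4 * X ^ (a + b + c + c)) := by
    rw [dumbbellPoly, C_ofNat]; ring
  have hd := natDegree_loopsPoly ha hb
  have h2 : (loopsPoly a b - C 4 * X ^ (a + b + c + c)).natDegree = a + b + c + c := by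
    by_cases hc : c = 0
    · have h3 : loopsPoly a b - C 4 * X ^ (a + b + c + c) =
          1 - X ^ a - X ^ b - C 3 * X ^ (a + b + c + c) := by
        rw [loopsPoly_eq, hc, C_neg, C_1, C_ofNat, C_ofNat]; ring
      rw [h3]
      refine natDegree_sub_C_mul_X_pow (by norm_num) ?_
      have := natDegree_one_sub_X_pow_sub_X_pow_le a b
      omega
    · exact natDegree_sub_C_mul_X_pow (by norm_num) (by omega)
  rw [h1, natDegree_mul, hd, h2]
  · omega
  · intro h
    rw [h, natDegree_zero] at hd
    omega
  · intro h
    rw [h, natDegree_zero] at h2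
    omega

lemma natDegree_cyclesPoly_lt {a b c : ℕ} (ha : a ≠ 0) (hb : b ≠ 0) (hc : c ≠ 0) :
    (cyclesPoly a b c).natDegree < a + b + c := by
  have := natDegree_sub_le_of_le (natDegree_one_sub_X_pow_sub_X_pow_le (a + b) (a + c))
    (natDegree_X_pow_le (R := ℂ) (b + c))
  rw [cyclesPoly]
  omega

lemma natDegree_thetaPoly {a b c : ℕ} (ha : a ≠ 0) (hb : b ≠ 0) (hc : c ≠ 0) :
    (thetaPoly a b c).natDegree = 2 * (a + b + c) := by
  have h := natDegree_cyclesPoly_lt ha hb hc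
  rw [thetaPoly, ← C_ofNat]
  refine natDegree_sub_C_mul_X_pow (by norm_num) ?_
  rw [natDegree_pow]
  omega

lemma coeff_zero_loopsPoly {a b : ℕ} (ha : a ≠ 0) (hb : b ≠ 0) : (loopsPoly a b).coeff 0 = 1 := by
  rw [coeff_zero_eq_eval_zero]
  simp [loopsPoly, ha, hb]

lemma coeff_zero_cyclesPoly {a b c : ℕ} (ha : a ≠ 0) (hb : b ≠ 0) :
    (cyclesPoly a b c).coeff 0 = 1 := by
  rw [coeff_zero_eq_eval_zero]
  simp [cyclesPoly, ha, hb]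

lemma eval_one_loopsPoly (a b : ℕ) : (loopsPoly a b).eval 1 = 0 := by simp [loopsPoly]

lemma eval_one_cyclesPoly (a b c : ℕ) : (cyclesPoly a b c).eval 1 = -2 := by
  simp [cyclesPoly]; norm_num

/-- Two polynomials with constant term one whose squares differ by a multiple of a power of `u`
differ by a multiple of that power. -/
lemma X_pow_dvd_sub {p q : ℂ[X]} {n : ℕ} (hp : p.coeff 0 = 1) (hq : q.coeff 0 = 1)
    (h : X ^ n ∣ p ^ 2 - q ^ 2) : X ^ n ∣ p - q := by
  refine prime_X.pow_dvd_of_dvd_mul_right (b := p + q) n ?_ ?_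
  · rw [X_dvd_iff, coeff_add, hp, hq]
    norm_num
  · convert h using 1
    ring

/-- The only multiples of `u ^ n` of degree at most `n` are its scalar multiples. -/
lemma exists_eq_C_mul_X_pow {p : ℂ[X]} {n : ℕ} (h : X ^ n ∣ p) (hd : p.natDegree ≤ n) :
    p = C (p.eval 1) * X ^ n := by
  obtain ⟨k, rfl⟩ := h
  by_cases hk : k = 0
  · simp [hk]
  · rw [natDegree_mul (pow_ne_zero _ X_ne_zero) hk, natDegree_X_pow] at hd
    rw [eq_C_of_natDegree_eq_zero (p := k) (by omega)]
    simp only [eval_mul, eval_pow, eval_X, one_pow, eval_C, one_mul]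
    exact mul_comm _ _

/-- Two dumbbells with the same zeta function have the same product `loopsPoly`: the two products
differ by a multiple of `u ^ (m + c)`, where `m` is the number of edges, have degree at most
`m - c`, and vanish at `1`. -/
lemma loopsPoly_eq_of_le {a b c a' b' c' : ℕ} (ha : a ≠ 0) (hb : b ≠ 0)
    (ha' : a' ≠ 0) (hb' : b' ≠ 0) (hm : a + b + c = a' + b' + c') (hc : c ≤ c')
    (h : dumbbellPoly a b c = dumbbellPoly a' b' c') : loopsPoly a b = loopsPoly a' b' := by
  have hdvd : X ^ (a + b + c + c) ∣ loopsPoly a b - loopsPoly a' b' := by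
    refine X_pow_dvd_sub (coeff_zero_loopsPoly ha hb) (coeff_zero_loopsPoly ha' hb') ?_
    refine ⟨4 * (loopsPoly a b - X ^ (c' - c) * loopsPoly a' b'), ?_⟩
    rw [dumbbellPoly, dumbbellPoly, show a' + b' + c' + c' = a + b + c + c + (c' - c) by omega,
      pow_add _ _ (c' - c)] at h
    linear_combination h
  have hdeg : (loopsPoly a b - loopsPoly a' b').natDegree ≤ a + b + c + c := by
    refine (natDegree_sub_le _ _).trans ?_
    rw [natDegree_loopsPoly ha hb, natDegree_loopsPoly ha' hb']
    omega
  have := exists_eq_C_mul_X_pow hdvd hdeg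
  rw [eval_sub, eval_one_loopsPoly, eval_one_loopsPoly, sub_zero, C_0, zero_mul] at this
  exact sub_eq_zero.1 this

/-- Pairs in increasing order with the same multiplicities are equal. -/
lemma eq_and_eq_of_indicators {a b a' b' : ℕ} (h1 : a ≤ b) (h2 : a' ≤ b')
    (h : ∀ n, (if n = a then 1 else 0) + (if n = b then 1 else 0) =
      (if n = a' then 1 else 0) + (if n = b' then 1 else 0)) : a = a' ∧ b = b' := by
  have e1 := h a
  have e2 := h a'
  have e3 := h b
  have e4 := h b'
  clear h
  grind

/-- Triples in increasing order with the same multiplicities are equal. -/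
lemma eq_and_eq_and_eq_of_indicators {a b c a' b' c' : ℕ} (h1 : a ≤ b) (h2 : b ≤ c) (h3 : a' ≤ b')
    (h4 : b' ≤ c')
    (h : ∀ n, (if n = a then 1 else 0) + (if n = b then 1 else 0) + (if n = c then 1 else 0) =
      (if n = a' then 1 else 0) + (if n = b' then 1 else 0) + (if n = c' then 1 else 0)) :
    a = a' ∧ b = b' ∧ c = c' := by
  have e : a = a' := by
    have e1 := h a
    have e2 := h a'
    clear h
    grind
  subst e
  refine ⟨rfl, eq_and_eq_of_indicators h2 h4 fun n => ?_⟩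
  have := h n
  omega

/-- The zeta function determines the lengths in a dumbbell or bouquet. -/
theorem dumbbellPoly_injective {a b c a' b' c' : ℕ} (ha : a ≠ 0) (hb : b ≠ 0)
    (ha' : a' ≠ 0) (hb' : b' ≠ 0) (hab : a ≤ b) (hab' : a' ≤ b')
    (h : dumbbellPoly a b c = dumbbellPoly a' b' c') : a = a' ∧ b = b' ∧ c = c' := by
  have hm := congrArg natDegree h
  rw [natDegree_dumbbellPoly ha hb, natDegree_dumbbellPoly ha' hb'] at hm
  have hR : loopsPoly a b = loopsPoly a' b' := by
    rcases le_total c c' with hc | hc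
    · exact loopsPoly_eq_of_le ha hb ha' hb' (by omega) hc h
    · exact (loopsPoly_eq_of_le ha' hb' ha hb (by omega) hc h.symm).symm
  have hs := congrArg natDegree hR
  rw [natDegree_loopsPoly ha hb, natDegree_loopsPoly ha' hb'] at hs
  rw [loopsPoly_eq, loopsPoly_eq, hs] at hR
  have hX : (X ^ a + X ^ b : ℂ[X]) = X ^ a' + X ^ b' := by linear_combination -hR
  have := eq_and_eq_of_indicators hab hab' fun n => by
    have := congrArg (fun p : ℂ[X] => p.coeff n) hX
    simp only [coeff_add, coeff_X_pow] at this
    exact_mod_cast this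
  omega

/-- The zeta function determines the lengths in a theta graph, through the lengths of its three
cycles. -/
theorem thetaPoly_injective {a b c a' b' c' : ℕ} (ha : a ≠ 0) (hb : b ≠ 0) (hc : c ≠ 0)
    (ha' : a' ≠ 0) (hb' : b' ≠ 0) (hc' : c' ≠ 0) (hab : a ≤ b) (hbc : b ≤ c) (hab' : a' ≤ b')
    (hbc' : b' ≤ c') (h : thetaPoly a b c = thetaPoly a' b' c') : a = a' ∧ b = b' ∧ c = c' := by
  have hm := congrArg natDegree h
  rw [natDegree_thetaPoly ha hb hc, natDegree_thetaPoly ha' hb' hc'] at hm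
  rw [thetaPoly, thetaPoly, hm, sub_left_inj, sq_eq_sq_iff_eq_or_eq_neg] at h
  rcases h with h | h
  · have hX : (X ^ (a + b) + X ^ (a + c) + X ^ (b + c) : ℂ[X]) =
        X ^ (a' + b') + X ^ (a' + c') + X ^ (b' + c') := by
      rw [cyclesPoly, cyclesPoly] at h
      linear_combination -h
    have := eq_and_eq_and_eq_of_indicators (a := a + b) (b := a + c) (c := b + c) (a' := a' + b')
        (b' := a' + c') (c' := b' + c') (by omega) (by omega) (by omega) (by omega) fun n => by
      have := congrArg (fun p : ℂ[X] => p.coeff n) hX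
      simp only [coeff_add, coeff_X_pow] at this
      exact_mod_cast this
    omega
  · have := congrArg (fun p : ℂ[X] => p.coeff 0) h
    simp only [coeff_neg, coeff_zero_cyclesPoly ha hb, coeff_zero_cyclesPoly ha' hb'] at this
    norm_num at this

/-- A theta graph and a dumbbell or bouquet have different zeta functions: for equal ones,
`cyclesPoly - loopsPoly` would be a multiple of `u ^ (m + c')`, with `m` the number of edges, which
its degree allows only if `c' = 0`, and then the leading coefficients do not match. -/
theorem thetaPoly_ne_dumbbellPoly {a b c a' b' c' : ℕ} (ha : a ≠ 0) (hb : b ≠ 0) (hc : c ≠ 0)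
    (ha' : a' ≠ 0) (hb' : b' ≠ 0) : thetaPoly a b c ≠ dumbbellPoly a' b' c' := by
  intro h
  have hm := congrArg natDegree h
  rw [natDegree_thetaPoly ha hb hc, natDegree_dumbbellPoly ha' hb'] at hm
  have hdS := natDegree_cyclesPoly_lt ha hb hc
  have hdR := natDegree_loopsPoly ha' hb'
  have hdvd : X ^ (a' + b' + c' + c') ∣ cyclesPoly a b c - loopsPoly a' b' := by
    refine X_pow_dvd_sub (coeff_zero_cyclesPoly ha hb) (coeff_zero_loopsPoly ha' hb') ?_
    refine ⟨4 * (X ^ (a' + b') - loopsPoly a' b'), ?_⟩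
    rw [thetaPoly, dumbbellPoly,
      show 2 * (a + b + c) = a' + b' + c' + c' + (a' + b') by omega, pow_add _ _ (a' + b')] at h
    linear_combination h
  have hdeg := natDegree_sub_le (cyclesPoly a b c) (loopsPoly a' b')
  have hk := exists_eq_C_mul_X_pow hdvd (by omega)
  rw [eval_sub, eval_one_loopsPoly, eval_one_cyclesPoly, sub_zero] at hk
  -- Compare the coefficients in degree `a' + b' + c' + c'`: it is `-2` on the right-hand side, and
  -- `0` or `-1` on the left.
  have hcoef := congrArg (fun p : ℂ[X] => p.coeff (a' + b' + c' + c')) hk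
  simp only [coeff_sub, coeff_C_mul, coeff_X_pow_self, mul_one] at hcoef
  rw [coeff_eq_zero_of_natDegree_lt (p := cyclesPoly a b c) (by omega), loopsPoly_eq] at hcoef
  simp only [coeff_sub, coeff_C_mul, coeff_X_pow, coeff_one] at hcoef
  rw [if_neg (by omega), if_neg (by omega), if_neg (by omega)] at hcoef
  split_ifs at hcoef <;> norm_num at hcoef

end Polynomials

/-! ### Classification of graphs of rank two by their ear lengths -/

section Classification

variable {V V' : Type*} [DecidableEq V] [DecidableEq V']

/-- The image of an ear under a map of the vertices. -/
def Ear.map {V V' : Type*} (σ : V → V') (e : Ear V) : Ear V' :=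
  ⟨σ e.first, e.interior.map σ, σ e.last⟩

lemma edgeMat_map {σ : V → V'} (hσ : Function.Injective σ) (p q x y : V) :
    edgeMat (σ p) (σ q) (σ x) (σ y) = edgeMat p q x y := by
  simp only [edgeMat_apply, hσ.eq_iff]

lemma earMat_map {σ : V → V'} (hσ : Function.Injective σ) (P : V) (l : List V) (Q x y : V) :
    earMat (σ P) (l.map σ) (σ Q) (σ x) (σ y) = earMat P l Q x y := by
  induction l generalizing P with
  | nil => exact edgeMat_map hσ P Q x y
  | cons v l ih => simp only [List.map_cons, earMat, Matrix.add_apply, edgeMat_map hσ, ih]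

lemma sum_earMat_map {σ : V → V'} (hσ : Function.Injective σ) (ears : List (Ear V)) (x y : V) :
    ((ears.map (Ear.map σ)).map Ear.mat).sum (σ x) (σ y) = (ears.map Ear.mat).sum x y := by
  induction ears with
  | nil => rfl
  | cons e r ih =>
    simp only [List.map_cons, List.sum_cons, Matrix.add_apply, ih]
    rw [Ear.map, Ear.mat, earMat_map hσ, Ear.mat]

lemma earMat_append_singleton (P : V) (l : List V) (v Q : V) :
    earMat P (l ++ [v]) Q = earMat P l v + edgeMat v Q := by
  induction l generalizing P with
  | nil => rfl
  | cons w l ih => simp only [List.cons_append, earMat, ih, add_assoc]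

lemma earMat_reverse (P : V) (l : List V) (Q : V) : earMat Q l.reverse P = earMat P l Q := by
  induction l generalizing P with
  | nil => exact edgeMat_comm Q P
  | cons v l ih =>
    rw [List.reverse_cons, earMat_append_singleton, ih, earMat, edgeMat_comm v P, add_comm]

lemma IsEarDecomposition.perm {A : Matrix V V ℕ} {S : Finset V} {B : List V}
    {ears ears' : List (Ear V)} (h : IsEarDecomposition A S B ears) (hp : ears.Perm ears') :
    IsEarDecomposition A S B ears' := by
  have hf := (hp.flatMap_right Ear.interior).append_left B
  refine ⟨hf.nodup_iff.1 h.nodup, fun x => ?_, fun e he => h.ends_mem e (hp.mem_iff.2 he), ?_⟩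
  · rw [← hf.mem_iff, h.mem_iff]
  · rw [h.eq_sum, (hp.map Ear.mat).sum_eq]

/-- Two repetition-free enumerations of the same length are matched by a bijection. -/
lemma exists_equiv_map_eq {l : List V} {l' : List V'} (hl : l.Nodup) (hl' : l'.Nodup)
    (hm : ∀ x, x ∈ l) (hm' : ∀ x, x ∈ l') (hlen : l.length = l'.length) :
    ∃ σ : V ≃ V', l.map σ = l' := by
  refine ⟨(hl.getEquivOfForallMemList l hm).symm.trans
    ((finCongr hlen).trans (hl'.getEquivOfForallMemList l' hm')), ?_⟩
  refine List.ext_getElem (by simpa using hlen) fun i h1 h2 => ?_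
  simp [hl.idxOf_getElem]

lemma map_interior_eq_of_flatMap_eq {V V' : Type*} {σ : V → V'} {ears : List (Ear V)}
    {ears' : List (Ear V')}
    (hlen : ears.map Ear.length = ears'.map Ear.length)
    (h : (ears.flatMap Ear.interior).map σ = ears'.flatMap Ear.interior) :
    ears.map (fun e => e.interior.map σ) = ears'.map Ear.interior := by
  induction ears generalizing ears' with
  | nil =>
    cases ears' with
    | nil => rfl
    | cons => simp at hlen
  | cons e r ih =>
    cases ears' with
    | nil => simp at hlen
    | cons e' r' =>
      simp only [List.map_cons, List.cons.injEq, Ear.length, add_left_inj] at hlen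
      rw [List.flatMap_cons, List.flatMap_cons, List.map_append] at h
      obtain ⟨h1, h2⟩ := List.append_inj h (by simpa using hlen.1)
      rw [List.map_cons, List.map_cons, h1, ih hlen.2 h2]

variable [Fintype V] [Fintype V']

/-- Two graphs made of ears of the same lengths: there is a bijection of the vertices that matches
the branch vertices and the interior vertices of the ears. -/
lemma IsEarDecomposition.exists_equiv {A : Matrix V V ℕ} {A' : Matrix V' V' ℕ} {B : List V}
    {B' : List V'} {ears : List (Ear V)} {ears' : List (Ear V')}
    (h : IsEarDecomposition A Finset.univ B ears) (h' : IsEarDecomposition A' Finset.univ B' ears')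
    (hB : B.length = B'.length) (hlen : ears.map Ear.length = ears'.map Ear.length) :
    ∃ σ : V ≃ V', B.map σ = B' ∧ ears.map (fun e => e.interior.map σ) = ears'.map Ear.interior := by
  have hlen2 : ears.map (fun e => e.interior.length) = ears'.map (fun e => e.interior.length) := by
    have := congrArg (List.map fun n => n - 1) hlen
    rw [List.map_map, List.map_map] at this
    exact this
  obtain ⟨σ, hσ⟩ := exists_equiv_map_eq h.nodup h'.nodup (fun x => by simp [h.mem_iff])
    (fun x => by simp [h'.mem_iff])
    (by rw [List.length_append, List.length_append, hB, List.length_flatMap, List.length_flatMap,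
      hlen2])
  rw [List.map_append] at hσ
  obtain ⟨h1, h2⟩ := List.append_inj hσ (by simpa using hB)
  exact ⟨σ, h1, map_interior_eq_of_flatMap_eq hlen h2⟩

lemma IsEarDecomposition.apply_eq {A : Matrix V V ℕ} {A' : Matrix V' V' ℕ} {B : List V}
    {B' : List V'} {ears : List (Ear V)} {ears' : List (Ear V')}
    (h : IsEarDecomposition A Finset.univ B ears) (h' : IsEarDecomposition A' Finset.univ B' ears')
    (σ : V ≃ V') (hσ : ears.map (Ear.map σ) = ears') (x y : V) : A x y = A' (σ x) (σ y) := by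
  rw [h.eq_sum, h'.eq_sum, ← hσ, sum_earMat_map σ.injective]

/-- `A` is the adjacency matrix of a theta graph with paths of lengths `a`, `b` and `c`. -/
def IsTheta (A : Matrix V V ℕ) (a b c : ℕ) : Prop :=
  ∃ (P Q : V) (l₁ l₂ l₃ : List V),
    IsEarDecomposition A Finset.univ [P, Q] [⟨P, l₁, Q⟩, ⟨P, l₂, Q⟩, ⟨P, l₃, Q⟩] ∧
    l₁.length + 1 = a ∧ l₂.length + 1 = b ∧ l₃.length + 1 = c

/-- `A` is the adjacency matrix of two cycles of lengths `a` and `b` with one common vertex. -/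
def IsBouquet (A : Matrix V V ℕ) (a b : ℕ) : Prop :=
  ∃ (P : V) (l₁ l₂ : List V), IsEarDecomposition A Finset.univ [P] [⟨P, l₁, P⟩, ⟨P, l₂, P⟩] ∧
    l₁.length + 1 = a ∧ l₂.length + 1 = b

/-- `A` is the adjacency matrix of two disjoint cycles of lengths `a` and `b` joined by a path of
length `c`. -/
def IsDumbbell (A : Matrix V V ℕ) (a b c : ℕ) : Prop :=
  ∃ (P Q : V) (l₁ l₂ l₃ : List V),
    IsEarDecomposition A Finset.univ [P, Q] [⟨P, l₁, P⟩, ⟨P, l₃, Q⟩, ⟨Q, l₂, Q⟩] ∧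
    l₁.length + 1 = a ∧ l₂.length + 1 = b ∧ l₃.length + 1 = c

lemma IsBouquet.symm {A : Matrix V V ℕ} {a b : ℕ} : IsBouquet A a b → IsBouquet A b a := by
  rintro ⟨P, l₁, l₂, h, h1, h2⟩
  exact ⟨P, l₂, l₁, h.perm (.swap _ _ _), h2, h1⟩

lemma IsDumbbell.symm {A : Matrix V V ℕ} {a b c : ℕ} : IsDumbbell A a b c → IsDumbbell A b a c := by
  rintro ⟨P, Q, l₁, l₂, l₃, h, h1, h2, h3⟩
  have hperm : ([P, Q] ++ List.flatMap Ear.interior [⟨P, l₁, P⟩, ⟨P, l₃, Q⟩, ⟨Q, l₂, Q⟩]).Perm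
      ([Q, P] ++ List.flatMap Ear.interior [⟨Q, l₂, Q⟩, ⟨Q, l₃.reverse, P⟩, ⟨P, l₁, P⟩]) := by
    rw [List.perm_iff_count]
    intro a
    simp only [List.flatMap_cons, List.flatMap_nil, List.count_append, List.count_cons,
      List.count_nil, List.count_reverse]
    omega
  refine ⟨Q, P, l₂, l₁, l₃.reverse, ⟨hperm.nodup_iff.1 h.nodup, fun x => ?_, by simp, ?_⟩, h2, h1,
    by simpa using h3⟩
  · rw [← hperm.mem_iff, h.mem_iff]
  · rw [h.eq_sum]
    simp only [List.map_cons, List.map_nil, List.sum_cons, List.sum_nil, Ear.mat, earMat_reverse]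
    abel

/-- Rank two graphs are thetas, bouquets or dumbbells, with parameters in increasing order. -/
theorem IsRankTwoOn.classification {A : Matrix V V ℕ} (h : IsRankTwoOn A Finset.univ) :
    (∃ a b c, a ≤ b ∧ b ≤ c ∧ IsTheta A a b c) ∨ (∃ a b, a ≤ b ∧ IsBouquet A a b) ∨
      ∃ a b c, a ≤ b ∧ IsDumbbell A a b c := by
  obtain ⟨B, ears, hd, ⟨P, rfl, he⟩ | ⟨P, Q, rfl, he⟩ | ⟨P, Q, rfl, he⟩⟩ := h.exists_earDecomposition
  · right; left
    match ears, he with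
    | [⟨_, l₁, _⟩, ⟨_, l₂, _⟩], he =>
      simp only [Ear.ends, List.map_cons, List.map_nil, List.cons.injEq, Prod.mk.injEq,
        and_true] at he
      obtain ⟨⟨rfl, rfl⟩, rfl, rfl⟩ := he
      have hb : IsBouquet A _ _ := ⟨_, l₁, l₂, hd, rfl, rfl⟩
      rcases le_total (l₁.length + 1) (l₂.length + 1) with hl | hl
      · exact ⟨_, _, hl, hb⟩
      · exact ⟨_, _, hl, hb.symm⟩
  · left
    have hperm := List.mergeSort_perm ears (fun e f => decide (e.length ≤ f.length))
    have hsort := List.pairwise_mergeSort (le := fun e f : Ear V => decide (e.length ≤ f.length))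
      (by simpa using fun a b c => le_trans) (by simpa using fun a b => le_total _ _) ears
    have hd' := hd.perm hperm.symm
    have hmem : ∀ e ∈ ears, e.ends = (P, Q) := by
      intro e hm
      have := List.mem_map_of_mem (f := Ear.ends) hm
      rw [he] at this
      simpa using this
    have hmem' : ∀ e ∈ ears.mergeSort (fun e f => decide (e.length ≤ f.length)), e.ends = (P, Q) :=
      fun e hm => hmem e (hperm.mem_iff.1 hm)
    have hlen : (ears.mergeSort (fun e f => decide (e.length ≤ f.length))).length = 3 := by
      rw [hperm.length_eq]
      simpa using congrArg List.length he
    generalize ears.mergeSort (fun e f => decide (e.length ≤ f.length)) = ears' at *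
    match ears', hlen with
    | [⟨P₁, l₁, Q₁⟩, ⟨P₂, l₂, Q₂⟩, ⟨P₃, l₃, Q₃⟩], _ =>
      simp only [List.mem_cons, List.not_mem_nil, or_false, forall_eq_or_imp, forall_eq, Ear.ends,
        Prod.mk.injEq] at hmem'
      obtain ⟨⟨rfl, rfl⟩, ⟨rfl, rfl⟩, ⟨rfl, rfl⟩⟩ := hmem'
      simp only [List.pairwise_cons, List.mem_cons, List.not_mem_nil, or_false, forall_eq_or_imp,
        forall_eq, Ear.length] at hsort
      exact ⟨_, _, _, of_decide_eq_true hsort.1.1, of_decide_eq_true hsort.2.1, _, _, l₁, l₂, l₃, hd',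
        rfl, rfl, rfl⟩
  · right; right
    match ears, he with
    | [⟨_, l₁, _⟩, ⟨_, l₃, _⟩, ⟨_, l₂, _⟩], he =>
      simp only [Ear.ends, List.map_cons, List.map_nil, List.cons.injEq, Prod.mk.injEq,
        and_true] at he
      obtain ⟨⟨rfl, rfl⟩, ⟨rfl, rfl⟩, rfl, h5⟩ := he
      subst h5
      have hb : IsDumbbell A _ _ _ := ⟨_, _, l₁, l₂, l₃, hd, rfl, rfl, rfl⟩
      rcases le_total (l₁.length + 1) (l₂.length + 1) with hl | hl
      · exact ⟨_, _, _, hl, hb⟩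
      · exact ⟨_, _, _, hl, hb.symm⟩

lemma IsTheta.exists_equiv {A : Matrix V V ℕ} {A' : Matrix V' V' ℕ} {a b c : ℕ}
    (h : IsTheta A a b c) (h' : IsTheta A' a b c) :
    ∃ σ : V ≃ V', ∀ x y, A x y = A' (σ x) (σ y) := by
  obtain ⟨P, Q, l₁, l₂, l₃, h, rfl, rfl, rfl⟩ := h
  obtain ⟨P', Q', l₁', l₂', l₃', h', h1, h2, h3⟩ := h'
  obtain ⟨σ, hB, hI⟩ := h.exists_equiv h' rfl (by simp [Ear.length, h1, h2, h3])
  simp only [List.map_cons, List.map_nil, List.cons.injEq, and_true] at hB hI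
  exact ⟨σ, h.apply_eq h' σ (by simp [Ear.map, hB, hI])⟩

lemma IsBouquet.exists_equiv {A : Matrix V V ℕ} {A' : Matrix V' V' ℕ} {a b : ℕ}
    (h : IsBouquet A a b) (h' : IsBouquet A' a b) :
    ∃ σ : V ≃ V', ∀ x y, A x y = A' (σ x) (σ y) := by
  obtain ⟨P, l₁, l₂, h, rfl, rfl⟩ := h
  obtain ⟨P', l₁', l₂', h', h1, h2⟩ := h'
  obtain ⟨σ, hB, hI⟩ := h.exists_equiv h' rfl (by simp [Ear.length, h1, h2])
  simp only [List.map_cons, List.map_nil, List.cons.injEq, and_true] at hB hI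
  exact ⟨σ, h.apply_eq h' σ (by simp [Ear.map, hB, hI])⟩

lemma IsDumbbell.exists_equiv {A : Matrix V V ℕ} {A' : Matrix V' V' ℕ} {a b c : ℕ}
    (h : IsDumbbell A a b c) (h' : IsDumbbell A' a b c) :
    ∃ σ : V ≃ V', ∀ x y, A x y = A' (σ x) (σ y) := by
  obtain ⟨P, Q, l₁, l₂, l₃, h, rfl, rfl, rfl⟩ := h
  obtain ⟨P', Q', l₁', l₂', l₃', h', h1, h2, h3⟩ := h'
  obtain ⟨σ, hB, hI⟩ := h.exists_equiv h' rfl (by simp [Ear.length, h1, h2, h3])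
  simp only [List.map_cons, List.map_nil, List.cons.injEq, and_true] at hB hI
  exact ⟨σ, h.apply_eq h' σ (by simp [Ear.map, hB, hI])⟩

lemma one_sub_X_pow_ne_zero (k : ℕ) (hk : k ≠ 0) :
    1 - ((RatFunc.X : RatFunc ℂ) ^ k) ^ 2 ≠ 0 := by
  intro h
  have h1 : algebraMap (Polynomial ℂ) (RatFunc ℂ) (1 - (Polynomial.X ^ k) ^ 2) = 0 := by
    simpa using h
  rw [map_eq_zero_iff _ (RatFunc.algebraMap_injective ℂ)] at h1
  have h2 := congrArg (Polynomial.eval 0) h1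
  simp [hk] at h2

lemma IsTheta.zeta {A : Matrix V V ℕ} {a b c : ℕ} (h : IsTheta A a b c) :
    (1 - RatFunc.X ^ 2) * (fieldZetaMatrix A (RatFunc.X : RatFunc ℂ)).det =
      algebraMap _ _ (thetaPoly a b c) := by
  obtain ⟨P, Q, l₁, l₂, l₃, h, rfl, rfl, rfl⟩ := h
  have hPQ : P ≠ Q := by
    have := h.nodup
    simp only [List.cons_append, List.nodup_cons, List.mem_cons, not_or] at this
    exact this.1.1
  rw [det_fieldZetaMatrix one_sub_X_pow_ne_zero h rfl]
  simp only [List.map_cons, List.map_nil, List.sum_cons, List.sum_nil, List.prod_cons,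
    List.prod_nil, Ear.length, add_zero, mul_one]
  rw [← add_assoc (linkMat _ _ _), ← mul_assoc, det_one_add_linkMat_theta hPQ
    (one_sub_X_pow_ne_zero _ (by omega)) (one_sub_X_pow_ne_zero _ (by omega))
    (one_sub_X_pow_ne_zero _ (by omega))]
  simp only [thetaPoly, cyclesPoly, map_sub, map_pow, map_mul, map_one, map_ofNat,
    RatFunc.algebraMap_X]
  ring

lemma IsBouquet.zeta {A : Matrix V V ℕ} {a b : ℕ} (h : IsBouquet A a b) :
    (1 - RatFunc.X ^ 2) * (fieldZetaMatrix A (RatFunc.X : RatFunc ℂ)).det =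
      algebraMap _ _ (dumbbellPoly a b 0) := by
  obtain ⟨P, l₁, l₂, h, rfl, rfl⟩ := h
  rw [det_fieldZetaMatrix one_sub_X_pow_ne_zero h rfl]
  simp only [List.map_cons, List.map_nil, List.sum_cons, List.sum_nil, List.prod_cons,
    List.prod_nil, Ear.length, add_zero, mul_one]
  rw [det_one_add_linkMat_bouquet P
    (one_sub_X_pow_ne_zero _ (by omega)) (one_sub_X_pow_ne_zero _ (by omega))]
  simp only [dumbbellPoly, loopsPoly, map_sub, map_pow, map_mul, map_one, map_ofNat,
    RatFunc.algebraMap_X]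
  ring

lemma IsDumbbell.zeta {A : Matrix V V ℕ} {a b c : ℕ} (h : IsDumbbell A a b c) :
    (1 - RatFunc.X ^ 2) * (fieldZetaMatrix A (RatFunc.X : RatFunc ℂ)).det =
      algebraMap _ _ (dumbbellPoly a b c) := by
  obtain ⟨P, Q, l₁, l₂, l₃, h, rfl, rfl, rfl⟩ := h
  have hPQ : P ≠ Q := by
    have := h.nodup
    simp only [List.cons_append, List.nodup_cons, List.mem_cons, not_or] at this
    exact this.1.1
  rw [det_fieldZetaMatrix one_sub_X_pow_ne_zero h rfl]
  simp only [List.map_cons, List.map_nil, List.sum_cons, List.sum_nil, List.prod_cons,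
    List.prod_nil, Ear.length, add_zero, mul_one]
  rw [← add_assoc (linkMat _ _ _), ← mul_assoc, det_one_add_linkMat_dumbbell hPQ
    (one_sub_X_pow_ne_zero _ (by omega)) (one_sub_X_pow_ne_zero _ (by omega))
    (one_sub_X_pow_ne_zero _ (by omega))]
  simp only [dumbbellPoly, loopsPoly, map_sub, map_pow, map_mul, map_one, map_ofNat,
    RatFunc.algebraMap_X]
  ring

lemma IsTheta.ne_zero {A : Matrix V V ℕ} {a b c : ℕ} (h : IsTheta A a b c) :
    a ≠ 0 ∧ b ≠ 0 ∧ c ≠ 0 := by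
  obtain ⟨P, Q, l₁, l₂, l₃, h, rfl, rfl, rfl⟩ := h
  simp

lemma IsBouquet.ne_zero {A : Matrix V V ℕ} {a b : ℕ} (h : IsBouquet A a b) : a ≠ 0 ∧ b ≠ 0 := by
  obtain ⟨P, l₁, l₂, h, rfl, rfl⟩ := h
  simp

lemma IsDumbbell.ne_zero {A : Matrix V V ℕ} {a b c : ℕ} (h : IsDumbbell A a b c) :
    a ≠ 0 ∧ b ≠ 0 ∧ c ≠ 0 := by
  obtain ⟨P, Q, l₁, l₂, l₃, h, rfl, rfl, rfl⟩ := h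
  simp

/-- Rank two graphs with the same zeta function have equivalent adjacency matrices. -/
theorem IsRankTwoOn.exists_equiv_of_det_eq {A : Matrix V V ℕ} {A' : Matrix V' V' ℕ}
    (h : IsRankTwoOn A Finset.univ) (h' : IsRankTwoOn A' Finset.univ)
    (hdet : (fieldZetaMatrix A (RatFunc.X : RatFunc ℂ)).det =
      (fieldZetaMatrix A' (RatFunc.X : RatFunc ℂ)).det) :
    ∃ σ : V ≃ V', ∀ x y, A x y = A' (σ x) (σ y) := by
  have key : ∀ {p q : Polynomial ℂ},
      (1 - RatFunc.X ^ 2) * (fieldZetaMatrix A (RatFunc.X : RatFunc ℂ)).det =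
        algebraMap _ _ p →
      (1 - RatFunc.X ^ 2) * (fieldZetaMatrix A' (RatFunc.X : RatFunc ℂ)).det =
        algebraMap _ _ q → p = q := by
    intro p q hp hq
    rw [hdet, hq] at hp
    exact (RatFunc.algebraMap_injective ℂ hp).symm
  rcases h.classification with ⟨a, b, c, hab, hbc, hA⟩ | ⟨a, b, hab, hA⟩ | ⟨a, b, c, hab, hA⟩ <;>
    rcases h'.classification with ⟨a', b', c', hab', hbc', hA'⟩ | ⟨a', b', hab', hA'⟩ |
      ⟨a', b', c', hab', hA'⟩ <;>
    have hz := hA.ne_zero <;> have hz' := hA'.ne_zero <;> have hp := key hA.zeta hA'.zeta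
  · obtain ⟨rfl, rfl, rfl⟩ := thetaPoly_injective hz.1 hz.2.1 hz.2.2 hz'.1 hz'.2.1 hz'.2.2 hab hbc
      hab' hbc' hp
    exact hA.exists_equiv hA'
  · exact absurd hp (thetaPoly_ne_dumbbellPoly hz.1 hz.2.1 hz.2.2 hz'.1 hz'.2)
  · exact absurd hp (thetaPoly_ne_dumbbellPoly hz.1 hz.2.1 hz.2.2 hz'.1 hz'.2.1)
  · exact absurd hp.symm (thetaPoly_ne_dumbbellPoly hz'.1 hz'.2.1 hz'.2.2 hz.1 hz.2)
  · obtain ⟨rfl, rfl, -⟩ := dumbbellPoly_injective hz.1 hz.2 hz'.1 hz'.2 hab hab' hp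
    exact hA.exists_equiv hA'
  · exact absurd (dumbbellPoly_injective hz.1 hz.2 hz'.1 hz'.2.1 hab hab' hp).2.2.symm hz'.2.2
  · exact absurd hp.symm (thetaPoly_ne_dumbbellPoly hz'.1 hz'.2.1 hz'.2.2 hz.1 hz.2.1)
  · exact absurd (dumbbellPoly_injective hz.1 hz.2.1 hz'.1 hz'.2 hab hab' hp).2.2 hz.2.2
  · obtain ⟨rfl, rfl, rfl⟩ := dumbbellPoly_injective hz.1 hz.2.1 hz'.1 hz'.2.1 hab hab' hp
    exact hA.exists_equiv hA'

end Classification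

/-! ### Adjacency matrices of multigraphs -/

section Adjacency

variable {α β α' β' : Type*} (G : Graph α β) (H : Graph α' β')

/-- Counting the edges with a property as a sum over the edges. -/
lemma ncard_setOf_eq_sum [Fintype E(G)] (P : β → Prop) [DecidablePred P]
    (hP : ∀ e, P e → e ∈ E(G)) : {e | P e}.ncard = ∑ e : E(G), if P e then 1 else 0 := by
  have h : {e | P e} = Subtype.val '' {e : E(G) | P e} := by
    ext e
    simp only [Set.mem_ofPred_eq, Set.mem_image, Subtype.exists, exists_and_left, exists_prop,
      exists_eq_right_right]
    exact ⟨fun h => ⟨h, hP e h⟩, fun h => h.1⟩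
  rw [h, Set.ncard_image_of_injective _ Subtype.val_injective, Set.ncard_eq_toFinset_card',
    Set.toFinset_ofPred, Finset.card_filter]

lemma exists_ends (e : E(G)) : ∃ p : V(G) × V(G), G.IsLink e p.1 p.2 := by
  obtain ⟨x, y, h⟩ := G.exists_isLink_of_mem_edgeSet e.2
  exact ⟨(⟨x, h.left_mem⟩, ⟨y, h.right_mem⟩), h⟩

/-- The two ends of an edge, in an arbitrary order. -/
noncomputable def ends (e : E(G)) : V(G) × V(G) := (G.exists_ends e).choose

lemma isLink_ends (e : E(G)) : G.IsLink e (G.ends e).1 (G.ends e).2 := (G.exists_ends e).choose_spec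

lemma isLink_iff_ends (e : E(G)) (x y : V(G)) :
    G.IsLink e x y ↔ ((G.ends e).1 = x ∧ (G.ends e).2 = y) ∨
      ((G.ends e).1 = y ∧ (G.ends e).2 = x) := by
  rw [(G.isLink_ends e).isLink_iff]
  simp only [Subtype.ext_iff]

lemma isNonloopAt_iff_ends (e : E(G)) (x : V(G)) :
    G.IsNonloopAt e x ↔ ((G.ends e).1 = x ∧ (G.ends e).2 ≠ x) ∨
      ((G.ends e).1 ≠ x ∧ (G.ends e).2 = x) := by
  constructor
  · rintro ⟨y, hy, h⟩
    have h' := (G.isLink_iff_ends e x ⟨y, h.right_mem⟩).1 h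
    have hy' : (⟨y, h.right_mem⟩ : V(G)) ≠ x := fun h => hy (congrArg Subtype.val h)
    rcases h' with ⟨h1, h2⟩ | ⟨h1, h2⟩
    · exact .inl ⟨h1, h2 ▸ hy'⟩
    · exact .inr ⟨h1 ▸ hy', h2⟩
  · rintro (⟨h1, h2⟩ | ⟨h1, h2⟩)
    · exact ⟨(G.ends e).2, fun h => h2 (Subtype.ext h), h1 ▸ G.isLink_ends e⟩
    · exact ⟨(G.ends e).1, fun h => h1 (Subtype.ext h), h2 ▸ (G.isLink_ends e).symm⟩

open Classical in
/-- The adjacency matrix is the sum of the matrices of the single edges; symmetry, parity of the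
diagonal, row sums and the total sum are read off from this. -/
lemma adjMatrix_eq_sum [Fintype E(G)] :
    G.adjMatrix = ∑ e, edgeMat (G.ends e).1 (G.ends e).2 := by
  ext x y
  rw [Matrix.sum_apply]
  by_cases hxy : x = y
  · subst hxy
    rw [adjMatrix, if_pos rfl, G.ncard_setOf_eq_sum (fun e => G.IsLoopAt e x)
      (fun e h => h.edge_mem), Finset.mul_sum]
    refine Finset.sum_congr rfl fun e _ => ?_
    rw [← G.isLink_self_iff, G.isLink_iff_ends, edgeMat_apply]
    simp only [eq_comm (a := x), or_self, and_comm]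
    split_ifs <;> simp_all
  · rw [adjMatrix, if_neg hxy, G.ncard_setOf_eq_sum (fun e => G.IsLink e x y)
      (fun e h => h.edge_mem)]
    refine Finset.sum_congr rfl fun e _ => ?_
    rw [G.isLink_iff_ends, edgeMat_apply]
    grind

open Classical in
lemma degree_eq_sum [Fintype V(G)] [Fintype E(G)] (x : V(G)) :
    G.degree x = ∑ y, G.adjMatrix x y := by
  rw [G.adjMatrix_eq_sum]
  simp only [Matrix.sum_apply]
  rw [Finset.sum_comm, degree, G.ncard_setOf_eq_sum (fun e => G.IsNonloopAt e x)
    (fun e h => h.edge_mem), G.ncard_setOf_eq_sum (fun e => G.IsLoopAt e x)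
    (fun e h => h.edge_mem), Finset.mul_sum, ← Finset.sum_add_distrib]
  refine Finset.sum_congr rfl fun e _ => ?_
  rw [sum_edgeMat, G.isNonloopAt_iff_ends, ← G.isLink_self_iff, G.isLink_iff_ends]
  grind

variable {G H}

open Classical in
/-- A connected graph of rank two without vertices of degree one has all degrees at least two,
because an isolated vertex would be the whole graph, of rank zero. -/
lemma isRankTwoOn_adjMatrix [Fintype V(G)] [Fintype E(G)] (hconn : G.Connected)
    (hdeg : ∀ x ∈ V(G), G.degree x ≠ 1) (hrank : G.rank = 2) :
    IsRankTwoOn G.adjMatrix Finset.univ := by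
  have hsymm : ∀ x y, G.adjMatrix x y = G.adjMatrix y x := by
    intro x y
    rw [G.adjMatrix_eq_sum, Matrix.sum_apply, Matrix.sum_apply]
    exact Finset.sum_congr rfl fun e _ => edgeMat_symm _ _ _ _
  have htotal : ∑ x, ∑ y, G.adjMatrix x y = 2 * (Finset.univ : Finset V(G)).card + 2 := by
    have h1 : ∑ x, ∑ y, G.adjMatrix x y = 2 * Fintype.card E(G) := by
      rw [G.adjMatrix_eq_sum]
      simp only [Matrix.sum_apply]
      rw [Finset.sum_congr rfl fun x _ => Finset.sum_comm, Finset.sum_comm]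
      simp only [sum_edgeMat, Finset.sum_add_distrib]
      simp [mul_comm, two_mul]
    rw [rank, ← Nat.card_coe_set_eq, ← Nat.card_coe_set_eq, Nat.card_eq_fintype_card,
      Nat.card_eq_fintype_card] at hrank
    rw [h1, Finset.card_univ]
    omega
  have hadj : ∀ x y : V(G), G.Adj x y → G.adjMatrix x y ≠ 0 := by
    rintro x y ⟨e, he⟩ h0
    rw [G.adjMatrix_eq_sum, Matrix.sum_apply, Finset.sum_eq_zero_iff] at h0
    have h1 := h0 ⟨e, he.edge_mem⟩ (Finset.mem_univ _)
    have h2 := (G.isLink_iff_ends ⟨e, he.edge_mem⟩ x y).1 he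
    rw [edgeMat_apply] at h1
    grind
  have hconn' : ∀ x y : V(G), Relation.ReflTransGen (fun a b => G.adjMatrix a b ≠ 0) x y := by
    intro x y
    have key : ∀ z, Relation.ReflTransGen G.Adj x z → ∀ hz : z ∈ V(G),
        Relation.ReflTransGen (fun a b => G.adjMatrix a b ≠ 0) x ⟨z, hz⟩ := by
      intro z h
      induction h with
      | refl => exact fun _ => .refl
      | tail _ hbc ih => exact fun hz => (ih hbc.left_mem).tail (hadj ⟨_, hbc.left_mem⟩ ⟨_, hz⟩ hbc)
    exact key y (hconn.2 x x.2 y y.2) y.2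
  refine ⟨hsymm, ?_, fun _ _ _ => Finset.mem_univ _, ?_, htotal, fun x _ y _ => hconn' x y⟩
  · intro x
    rw [G.adjMatrix_eq_sum, Matrix.sum_apply]
    exact Finset.even_sum _ fun e _ => even_edgeMat_diag _ _ _
  · intro x _
    have h1 := hdeg x x.2
    rw [G.degree_eq_sum] at h1
    -- In a connected graph, a vertex of degree zero is the only vertex.
    have h0 : ∑ y, G.adjMatrix x y ≠ 0 := by
      intro h0
      have h0' := h0
      rw [Finset.sum_eq_zero_iff] at h0
      have huniv : (Finset.univ : Finset V(G)) = {x} := by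
        refine Finset.eq_singleton_iff_unique_mem.2 ⟨Finset.mem_univ _, fun y _ => ?_⟩
        rcases (hconn' x y).cases_head with h | ⟨z, hz, -⟩
        · exact h.symm
        · exact absurd (h0 z (Finset.mem_univ _)) hz
      have h2 : ∑ x, ∑ y, G.adjMatrix x y = 0 := by
        rw [huniv, Finset.sum_singleton, ← huniv, h0']
      omega
    omega

open Classical in
lemma adjMatrix_eq_of_iso (φ : Iso G H) (x y : V(G)) :
    G.adjMatrix x y = H.adjMatrix (φ.vertexEquiv x) (φ.vertexEquiv y) := by
  have h : ∀ x y : V(G), {e | G.IsLink e x y}.ncard =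
      {e | H.IsLink e (φ.vertexEquiv x) (φ.vertexEquiv y)}.ncard := by
    intro x y
    refine Set.ncard_congr (fun e he => φ.edgeEquiv ⟨e, IsLink.edge_mem he⟩) ?_ ?_ ?_
    · intro e he
      exact (φ.isLink_iff ⟨e, _⟩ x y).1 he
    · intro e f he hf hef
      exact congrArg Subtype.val (φ.edgeEquiv.injective (Subtype.ext hef))
    · intro f hf
      refine ⟨φ.edgeEquiv.symm ⟨f, IsLink.edge_mem hf⟩, ?_, by simp⟩
      rw [Set.mem_ofPred_eq, φ.isLink_iff, Equiv.apply_symm_apply]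
      exact hf
  rw [adjMatrix, adjMatrix]
  simp only [φ.vertexEquiv.injective.eq_iff]
  split_ifs with hxy
  · exact congrArg (2 * ·) (h x x)
  · exact h x y

lemma sym2_mk_ends_eq_iff (e : E(G)) (x y : V(G)) :
    s((G.ends e).1, (G.ends e).2) = s(x, y) ↔ G.IsLink e x y := by
  rw [G.isLink_iff_ends, Sym2.eq_iff]

open Classical in
/-- Graphs with equivalent adjacency matrices are isomorphic: match the edges between each pair of
vertices. -/
lemma isomorphic_of_adjMatrix_eq [Fintype E(G)] [Fintype E(H)] (σ : V(G) ≃ V(H))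
    (h : ∀ x y, G.adjMatrix x y = H.adjMatrix (σ x) (σ y)) : G.Isomorphic H := by
  have hcard : ∀ x y : V(G), {e | G.IsLink e x y}.ncard = {e | H.IsLink e (σ x) (σ y)}.ncard := by
    intro x y
    have hxy := h x y
    simp only [adjMatrix, σ.injective.eq_iff] at hxy
    split_ifs at hxy with heq
    · subst heq
      exact Nat.eq_of_mul_eq_mul_left two_pos hxy
    · exact hxy
  let f : E(G) → Sym2 V(H) := fun e => Sym2.map σ s((G.ends e).1, (G.ends e).2)
  let g : E(H) → Sym2 V(H) := fun e => s((H.ends e).1, (H.ends e).2)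
  have hf : ∀ (e : E(G)) (x y : V(G)), f e = s(σ x, σ y) ↔ G.IsLink e x y := by
    intro e x y
    rw [← sym2_mk_ends_eq_iff, ← Sym2.map_mk, (Sym2.map.injective σ.injective).eq_iff]
  have hg : ∀ (e : E(H)) (x y : V(H)), g e = s(x, y) ↔ H.IsLink e x y := sym2_mk_ends_eq_iff
  have hfib : ∀ c : Sym2 V(H), Nonempty ({e // f e = c} ≃ {e // g e = c}) := by
    intro c
    induction c using Sym2.ind with
    | _ x y =>
      obtain ⟨x, rfl⟩ := σ.surjective x
      obtain ⟨y, rfl⟩ := σ.surjective y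
      refine ⟨Fintype.equivOfCardEq ?_⟩
      have := hcard x y
      rw [G.ncard_setOf_eq_sum (fun e => G.IsLink e x y) (fun e h => h.edge_mem),
        H.ncard_setOf_eq_sum (fun e => H.IsLink e (σ x) (σ y)) (fun e h => h.edge_mem),
        ← Finset.card_filter, ← Finset.card_filter] at this
      rw [Fintype.card_subtype, Fintype.card_subtype]
      simpa only [hf, hg] using this
  let ε : E(G) ≃ E(H) := Equiv.ofFiberEquiv fun c => (hfib c).some
  have hε : ∀ e, g (ε e) = f e := fun e => Equiv.ofFiberEquiv_map _ e
  exact ⟨⟨σ, ε, fun e x y => by rw [← hf, ← hg, hε]⟩⟩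

open Classical in
lemma algebraMap_det_zetaMatrix [Fintype V(G)] [Fintype E(G)] :
    algebraMap (Polynomial ℂ) (RatFunc ℂ) G.zetaMatrix.det =
      (fieldZetaMatrix G.adjMatrix (RatFunc.X : RatFunc ℂ)).det := by
  rw [RingHom.map_det]
  congr 1
  · ext x y
    simp only [zetaMatrix, fieldZetaMatrix, RingHom.mapMatrix_apply, Matrix.map_apply,
      Matrix.add_apply, Matrix.sub_apply, Matrix.smul_apply, smul_eq_mul, map_add, map_sub,
      map_mul, map_pow, RatFunc.algebraMap_X, map_natCast, Matrix.diagonal_apply, Matrix.one_apply,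
      ← G.degree_eq_sum]
    split_ifs <;> simp

end Adjacency

end Graph

theorem theorem4p1 {α₁ β₁ α₂ β₂ : Type*} (G₁ : Graph α₁ β₁) (G₂ : Graph α₂ β₂)
    [Fintype V(G₁)] [Finite E(G₁)] [Fintype V(G₂)] [Finite E(G₂)]
    (hconn₁ : G₁.Connected) (hconn₂ : G₂.Connected)
    (hdeg₁ : ∀ x ∈ V(G₁), G₁.degree x ≠ 1) (hdeg₂ : ∀ x ∈ V(G₂), G₂.degree x ≠ 1)
    (hrank₁ : G₁.rank = 2) (hrank₂ : G₂.rank = 2) :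
    G₁.Isomorphic G₂ ↔ G₁.iharaZeta = G₂.iharaZeta := by
  classical
  have := Fintype.ofFinite E(G₁)
  have := Fintype.ofFinite E(G₂)
  have hX : (1 - RatFunc.X ^ 2 : RatFunc ℂ) ≠ 0 := by
    simpa using Graph.one_sub_X_pow_ne_zero 1 one_ne_zero
  have hz : G₁.iharaZeta = G₂.iharaZeta ↔
      (Graph.fieldZetaMatrix G₁.adjMatrix (RatFunc.X : RatFunc ℂ)).det =
        (Graph.fieldZetaMatrix G₂.adjMatrix (RatFunc.X : RatFunc ℂ)).det := by
    rw [Graph.iharaZeta, Graph.iharaZeta, hrank₁, hrank₂, inv_inj]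
    norm_num only
    rw [zpow_one, mul_right_inj' hX, ← Graph.algebraMap_det_zetaMatrix,
      ← Graph.algebraMap_det_zetaMatrix]
  rw [hz]
  constructor
  · rintro ⟨φ⟩
    rw [← Matrix.det_submatrix_equiv_self φ.vertexEquiv]
    congr 1
    ext x y
    have hsum : ∑ y, G₂.adjMatrix (φ.vertexEquiv x) y = ∑ y, G₁.adjMatrix x y := by
      rw [← Equiv.sum_comp φ.vertexEquiv]
      simp only [Graph.adjMatrix_eq_of_iso φ]
    simp only [Graph.fieldZetaMatrix, Matrix.submatrix_apply, Matrix.add_apply, Matrix.sub_apply,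
      Matrix.smul_apply, Matrix.map_apply, Matrix.diagonal_apply, Matrix.one_apply,
      φ.vertexEquiv.injective.eq_iff, hsum, ← Graph.adjMatrix_eq_of_iso φ]
  · intro hdet
    obtain ⟨σ, hσ⟩ := (Graph.isRankTwoOn_adjMatrix hconn₁ hdeg₁ hrank₁).exists_equiv_of_det_eq
      (Graph.isRankTwoOn_adjMatrix hconn₂ hdeg₂ hrank₂) hdet
    exact Graph.isomorphic_of_adjMatrix_eq σ hσ
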